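/- Let $E$ be a real Banach lattice that is $\sigma$-Dedekind complete (every nonempty countable subset that is bounded above has a supremum). Then the following are equivalent. 1. The norm of $E$ is order continuous, i.e. $\|x_\alpha\|\to 0$ for every decreasing net $x_\alpha\downarrow 0$ in $E$. 2. Every order bounded weak almost limited operator $T:E\to E$ is almost Dunford–Pettis. Here an operator $T:E\to E$ is a bounded linear map, and $E^*$ is the dual Banach lattice, ordered by $f\le g$ iff $f(x)\le g(x)$ for all $x\ge 0$. A sequence in $E$ or in $E^*$ is disjoint if $|u_n|\wedge|u_m|=0$ for $n\ne m$. The operator $T$ is - order bounded if it maps each order interval $[a,b]$ into an order interval; - weak almost limited if it maps every relatively weakly compact subset of $E$ to an almost limited set, where $A\subseteq E$ is almost limited if it is norm bounded and every disjoint weak* null sequence $(f_n)$ in $E^*$ satisfies $\sup_{x\in A}|f_n(x)|\to 0$; - almost Dunford–Pettis if $\|Tx_n\|\to 0$ for every disjoint weakly null sequence $(x_n)$ in $E$. -/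

import Mathlib

open Filter Topology Set

namespace BanachLattice

/-- `E` is σ-Dedekind complete: every nonempty countable subset that is bounded above has a
supremum. -/
def SigmaDedekindComplete (E : Type*) [Lattice E] : Prop :=
  ∀ s : Set E, s.Countable → s.Nonempty → BddAbove s → ∃ a, IsLUB s a

/-- The norm of `E` is order continuous: `x_α ↓ 0` implies `‖x_α‖ → 0`, for all nets. -/
def HasOrderContinuousNorm.{u} (E : Type u) [NormedAddCommGroup E] [Lattice E] : Prop :=
  ∀ (ι : Type u) [Preorder ι] [IsDirectedOrder ι] [Nonempty ι] (x : ι → E),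
    Antitone x → IsGLB (range x) 0 → Tendsto (fun i => ‖x i‖) atTop (𝓝 0)

/-- A disjoint sequence of a vector lattice. -/
def DisjointSeq {E : Type*} [AddCommGroup E] [Lattice E] (x : ℕ → E) : Prop :=
  ∀ n m, n ≠ m → |x n| ⊓ |x m| = 0

section Dual

variable {E : Type*} [NormedAddCommGroup E] [NormedSpace ℝ E] [Lattice E]

/-- The order of the dual Banach lattice: `f ≤ g` iff `f x ≤ g x` for all `x ≥ 0`. -/
def DualLE (f g : StrongDual ℝ E) : Prop := ∀ x : E, 0 ≤ x → f x ≤ g x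

/-- `h` is the supremum `f ∨ g` in the dual. -/
def IsDualSup (f g h : StrongDual ℝ E) : Prop :=
  DualLE f h ∧ DualLE g h ∧ ∀ k, DualLE f k → DualLE g k → DualLE h k

/-- `h` is the infimum `f ∧ g` in the dual. -/
def IsDualInf (f g h : StrongDual ℝ E) : Prop :=
  DualLE h f ∧ DualLE h g ∧ ∀ k, DualLE k f → DualLE k g → DualLE k h

/-- `h` is the modulus `|f| = f ∨ (-f)` in the dual. -/
def IsDualAbs (f h : StrongDual ℝ E) : Prop := IsDualSup f (-f) h

/-- `|f| ∧ |g| = 0` in the dual. For a Banach lattice `E` the moduli exist and are unique. -/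
def DualDisjoint (f g : StrongDual ℝ E) : Prop :=
  ∃ p q : StrongDual ℝ E, IsDualAbs f p ∧ IsDualAbs g q ∧ IsDualInf p q 0

/-- A disjoint sequence of the dual Banach lattice. -/
def DisjointDualSeq (f : ℕ → StrongDual ℝ E) : Prop :=
  ∀ n m, n ≠ m → DualDisjoint (f n) (f m)

end Dual

/-- `x_n → 0` weakly. -/
def WeaklyNull {X : Type*} [NormedAddCommGroup X] [NormedSpace ℝ X] (x : ℕ → X) : Prop :=
  Tendsto (fun n => toWeakSpace ℝ X (x n)) atTop (𝓝 0)

/-- `f_n → 0` in the weak* topology of the dual of `X`. -/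
def WeakStarNull {X : Type*} [NormedAddCommGroup X] [NormedSpace ℝ X]
    (f : ℕ → StrongDual ℝ X) : Prop :=
  Tendsto (fun n => StrongDual.toWeakDual (f n)) atTop (𝓝 0)

/-- `W` has compact closure in the weak topology. -/
def RelativelyWeaklyCompact {X : Type*} [NormedAddCommGroup X] [NormedSpace ℝ X]
    (W : Set X) : Prop :=
  IsCompact (closure (toWeakSpace ℝ X '' W))

/-- A norm bounded set on which every disjoint weak* null sequence of the dual converges
uniformly to zero. -/
def AlmostLimited {E : Type*} [NormedAddCommGroup E] [NormedSpace ℝ E] [Lattice E]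
    (A : Set E) : Prop :=
  Bornology.IsBounded A ∧
    ∀ f : ℕ → StrongDual ℝ E, DisjointDualSeq f → WeakStarNull f →
      TendstoUniformlyOn (fun n x => f n x) (fun _ => 0) atTop A

/-- An operator that carries relatively weakly compact sets to almost limited sets. -/
def WeakAlmostLimited {X E : Type*} [NormedAddCommGroup X] [NormedSpace ℝ X]
    [NormedAddCommGroup E] [NormedSpace ℝ E] [Lattice E] (T : X →L[ℝ] E) : Prop :=
  ∀ W : Set X, RelativelyWeaklyCompact W → AlmostLimited (T '' W)

/-- An operator that carries disjoint weakly null sequences to norm null sequences. -/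
def AlmostDunfordPettis {E X : Type*} [NormedAddCommGroup E] [NormedSpace ℝ E] [Lattice E]
    [NormedAddCommGroup X] [NormedSpace ℝ X] (T : E →L[ℝ] X) : Prop :=
  ∀ x : ℕ → E, DisjointSeq x → WeaklyNull x → Tendsto (fun n => ‖T (x n)‖) atTop (𝓝 0)

/-- An operator that carries order intervals into order intervals. -/
def OrderBoundedOp {E F : Type*} [NormedAddCommGroup E] [NormedSpace ℝ E] [Lattice E]
    [NormedAddCommGroup F] [NormedSpace ℝ F] [Lattice F] (T : E →L[ℝ] F) : Prop :=
  ∀ a b : E, ∃ c d : F, T '' Icc a b ⊆ Icc c d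

end BanachLattice

set_option linter.unusedSectionVars false

namespace BanachLattice

/-! ### Disjointness and Riesz decomposition in vector lattices -/

section VectorLattice

variable {E : Type*} [AddCommGroup E] [Lattice E] [IsOrderedAddMonoid E]

/-! Both directions pass through `DisjointBoundedNull`, which for σ-Dedekind complete `E` is
equivalent to order continuity of the norm.

(1) ⇒ (2): let `x n` be disjoint and weakly null, and `A` the set of all `T (x n)`. Disjoint
positive minorants of moduli of elements of `A` are norm null: they carry disjoint functionals
forming a weak* null sequence, and `A` is almost limited. Hence `A` lies in an order interval up to
ε (`exists_almost_order_bound`). Order boundedness of `T` and Mazur's theorem give `f |T (x n)| → 0`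
for positive `f` (`OrderBoundedOp.tendsto_abs`), and disjointification (`exists_disjoint_minorant`)
turns this into norm convergence of the truncations `|T (x n)| ⊓ u`.

(2) ⇒ (1): a disjoint sequence `v n` in an order interval with norms at least ε gives positive maps
`E → ℓ^∞ → E` whose composite fixes every `v n`. The composite is weak almost limited, since weak*
null sequences in the dual of `ℓ^∞` converge uniformly on relatively weakly compact sets; this rests
on Riesz–Markov over βℕ, disjointification and Rosenthal's lemma. But `v` is disjoint and weakly
null without being norm null. -/

theorem add_inf_le {a b c : E} (ha : 0 ≤ a) (hb : 0 ≤ b) (hc : 0 ≤ c) :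
    (a + b) ⊓ c ≤ a ⊓ c + b ⊓ c := by
  rw [add_inf, inf_add, inf_add]
  refine le_inf (le_inf inf_le_left ?_) (le_inf ?_ ?_)
  · exact inf_le_right.trans (le_add_of_nonneg_right hb)
  · exact inf_le_right.trans (le_add_of_nonneg_left ha)
  · exact inf_le_right.trans (le_add_of_nonneg_left hc)

/-- Disjointness gives `|a| + |b| = ||a| - |b||`, which the reverse triangle inequality bounds by
`|a + b|`. -/
theorem abs_add_of_disjoint {a b : E} (h : |a| ⊓ |b| = 0) : |a + b| = |a| + |b| := by
  refine le_antisymm (abs_add_le a b) ?_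
  have h1 : |a| + |b| = |(|a| - |b|)| := by
    have := sup_sub_inf_eq_abs_sub |b| |a|
    have h2 := inf_add_sup |b| |a|
    rw [inf_comm, h] at this h2
    rw [← this, sub_zero, ← add_comm, ← h2, zero_add]
  have h3 := abs_abs_sub_abs_le a (-b)
  rw [abs_neg, sub_neg_eq_add] at h3
  rw [h1]
  exact h3

theorem sum_inf_le {ι : Type*} {s : Finset ι} {v : ι → E} {c : E} (hv : ∀ i ∈ s, 0 ≤ v i)
    (hc : 0 ≤ c) : (∑ i ∈ s, v i) ⊓ c ≤ ∑ i ∈ s, v i ⊓ c := by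
  classical
  induction s using Finset.induction_on with
  | empty => simp
  | insert j s hj ih =>
    rw [Finset.sum_insert hj, Finset.sum_insert hj]
    have hs : ∀ i ∈ s, 0 ≤ v i := fun i hi => hv i (Finset.mem_insert_of_mem hi)
    exact (add_inf_le (hv j (Finset.mem_insert_self j s)) (Finset.sum_nonneg hs) hc).trans
      (add_le_add_right (ih hs) _)

theorem abs_sum_of_disjoint {ι : Type*} {s : Finset ι} {v : ι → E}
    (h : ∀ i ∈ s, ∀ j ∈ s, i ≠ j → |v i| ⊓ |v j| = 0) : |∑ i ∈ s, v i| = ∑ i ∈ s, |v i| := by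
  classical
  induction s using Finset.induction_on with
  | empty => simp
  | insert j s hj ih =>
    rw [Finset.sum_insert hj, Finset.sum_insert hj]
    have ih' := ih fun i hi k hk => h i (Finset.mem_insert_of_mem hi) k (Finset.mem_insert_of_mem hk)
    rw [abs_add_of_disjoint, ih']
    rw [ih', inf_comm]
    refine le_antisymm ((sum_inf_le (fun i _ => abs_nonneg _) (abs_nonneg _)).trans ?_)
      (le_inf (Finset.sum_nonneg fun i _ => abs_nonneg _) (abs_nonneg _))
    refine (Finset.sum_eq_zero fun i hi => ?_).le
    exact h i (Finset.mem_insert_of_mem hi) j (Finset.mem_insert_self j s)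
      (ne_of_mem_of_not_mem hi hj)

/-- A sum of disjoint positive elements is their supremum. -/
theorem sum_le_of_disjoint {ι : Type*} {s : Finset ι} {v : ι → E} {u : E}
    (h0 : ∀ i ∈ s, 0 ≤ v i) (hu0 : 0 ≤ u) (hu : ∀ i ∈ s, v i ≤ u)
    (h : ∀ i ∈ s, ∀ j ∈ s, i ≠ j → v i ⊓ v j = 0) : ∑ i ∈ s, v i ≤ u := by
  classical
  induction s using Finset.induction_on with
  | empty => simpa
  | insert j s hj ih =>
    rw [Finset.sum_insert hj]
    have hs : ∀ i ∈ s, 0 ≤ v i := fun i hi => h0 i (Finset.mem_insert_of_mem hi)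
    have hj0 := h0 j (Finset.mem_insert_self j s)
    have ih' := ih hs (fun i hi => hu i (Finset.mem_insert_of_mem hi))
      fun i hi k hk => h i (Finset.mem_insert_of_mem hi) k (Finset.mem_insert_of_mem hk)
    have hz : v j ⊓ ∑ i ∈ s, v i = 0 := by
      rw [inf_comm]
      refine le_antisymm ((sum_inf_le hs hj0).trans ?_) (le_inf (Finset.sum_nonneg hs) hj0)
      refine (Finset.sum_eq_zero fun i hi => ?_).le
      exact h i (Finset.mem_insert_of_mem hi) j (Finset.mem_insert_self j s)
        (ne_of_mem_of_not_mem hi hj)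
    rw [← inf_add_sup, hz, zero_add]
    exact sup_le (hu j (Finset.mem_insert_self j s)) ih'

theorem inf_eq_zero_of_le {a b c d : E} (ha : 0 ≤ a) (hb : 0 ≤ b) (hac : a ≤ c) (hbd : b ≤ d)
    (h : c ⊓ d = 0) : a ⊓ b = 0 :=
  le_antisymm ((inf_le_inf hac hbd).trans h.le) (le_inf ha hb)

/-- A Riesz decomposition: truncating `y` at `±a`. -/
theorem exists_add_of_abs_le_add {y a b : E} (ha : 0 ≤ a) (hb : 0 ≤ b) (h : |y| ≤ a + b) :
    ∃ y₁ y₂, y = y₁ + y₂ ∧ |y₁| ≤ a ∧ |y₂| ≤ b := by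
  obtain ⟨h1, h2⟩ := abs_le'.1 h
  refine ⟨(y ⊓ a) ⊔ (-a), y - (y ⊓ a) ⊔ (-a), by abel, abs_le'.2 ⟨?_, ?_⟩, abs_le'.2 ⟨?_, ?_⟩⟩
  · exact sup_le inf_le_right (neg_le_self ha)
  · exact neg_le.1 le_sup_right
  · rw [sub_le_comm]
    refine le_trans (le_inf ?_ ?_) le_sup_left
    · exact sub_le_self _ hb
    · exact sub_le_iff_le_add.2 h1
  · rw [neg_sub, sub_le_iff_le_add]
    refine sup_le (inf_le_left.trans (le_add_of_nonneg_left hb)) ?_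
    rw [neg_le, neg_add, ← sub_eq_add_neg, sub_eq_add_neg, neg_add_eq_sub]
    rw [sub_le_iff_le_add]
    exact h2

theorem sup_sub_inf_sup_sub (a b : E) : ((a - b) ⊔ 0) ⊓ ((b - a) ⊔ 0) = 0 := by
  have := posPart_inf_negPart_eq_zero (a - b)
  rwa [negPart_def, posPart_def, neg_sub] at this

end VectorLattice

/-! ### Scalars, and extension from the positive cone -/

section VectorLatticeModule

variable {E : Type*} [AddCommGroup E] [Lattice E] [IsOrderedAddMonoid E] [Module ℝ E]
  [IsOrderedModule ℝ E]

theorem smul_inf_of_pos {c : ℝ} (hc : 0 < c) (a b : E) : c • (a ⊓ b) = c • a ⊓ c • b :=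
  (OrderIso.smulRight hc).map_inf a b

theorem smul_sup_of_pos {c : ℝ} (hc : 0 < c) (a b : E) : c • (a ⊔ b) = c • a ⊔ c • b :=
  (OrderIso.smulRight hc).map_sup a b

theorem abs_smul_of_nonneg {c : ℝ} (hc : 0 ≤ c) (a : E) : |c • a| = c • |a| := by
  rcases hc.eq_or_lt with rfl | h
  · simp
  · rw [abs, abs, smul_sup_of_pos h, smul_neg]

theorem smul_inf_smul_eq_zero {a b : E} (ha : 0 ≤ a) (hb : 0 ≤ b) (h : a ⊓ b = 0) {c d : ℝ}
    (hc : 0 ≤ c) (hd : 0 ≤ d) : (c • a) ⊓ (d • b) = 0 := by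
  have hm : 0 < max c d + 1 := by positivity
  refine inf_eq_zero_of_le (smul_nonneg hc ha) (smul_nonneg hd hb)
    (smul_le_smul_of_nonneg_right (show c ≤ max c d + 1 by linarith [le_max_left c d]) ha)
    (smul_le_smul_of_nonneg_right (show d ≤ max c d + 1 by linarith [le_max_right c d]) hb) ?_
  rw [← smul_inf_of_pos hm, h, smul_zero]

/-- A positively homogeneous additive map on the positive cone extends to a linear map. -/
theorem exists_linearMap_eq_on_cone {F : Type*} [AddCommGroup F] [Module ℝ F] (q : E → F)
    (hadd : ∀ x y, 0 ≤ x → 0 ≤ y → q (x + y) = q x + q y)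
    (hsmul : ∀ (c : ℝ) x, 0 < c → 0 ≤ x → q (c • x) = c • q x) :
    ∃ L : E →ₗ[ℝ] F, ∀ x, 0 ≤ x → L x = q x := by
  have q0 : q 0 = 0 := by simpa using hadd 0 0 le_rfl le_rfl
  have key : ∀ a b : E, 0 ≤ a → 0 ≤ b → q (a - b)⁺ - q (a - b)⁻ = q a - q b := by
    intro a b ha hb
    have h1 : (a - b)⁺ + b = a + (a - b)⁻ := by
      have := posPart_sub_negPart (a - b)
      rw [sub_eq_sub_iff_add_eq_add] at this
      exact this
    have h2 := congrArg q h1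
    rw [hadd _ _ (posPart_nonneg _) hb, hadd _ _ ha (negPart_nonneg _)] at h2
    rw [sub_eq_sub_iff_add_eq_add, h2]
  have hsmul' : ∀ (c : ℝ) x, 0 ≤ c → 0 ≤ x → q (c • x) = c • q x := by
    intro c x hc hx
    rcases hc.eq_or_lt with rfl | h
    · simp [q0]
    · exact hsmul c x h hx
  refine ⟨{ toFun := fun x => q x⁺ - q x⁻, map_add' := ?_, map_smul' := ?_ }, ?_⟩
  · intro x y
    have h := key (x⁺ + y⁺) (x⁻ + y⁻) (add_nonneg (posPart_nonneg _) (posPart_nonneg _))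
      (add_nonneg (negPart_nonneg _) (negPart_nonneg _))
    rw [add_sub_add_comm, posPart_sub_negPart, posPart_sub_negPart] at h
    rw [h, hadd _ _ (posPart_nonneg _) (posPart_nonneg _),
      hadd _ _ (negPart_nonneg _) (negPart_nonneg _)]
    abel
  · intro c x
    rcases le_total 0 c with hc | hc
    · have h := key (c • x⁺) (c • x⁻) (smul_nonneg hc (posPart_nonneg _))
        (smul_nonneg hc (negPart_nonneg _))
      rw [← smul_sub, posPart_sub_negPart] at h
      rw [h, hsmul' _ _ hc (posPart_nonneg _), hsmul' _ _ hc (negPart_nonneg _)]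
      simp [smul_sub]
    · have hc' : 0 ≤ -c := neg_nonneg.2 hc
      have h := key (-c • x⁻) (-c • x⁺) (smul_nonneg hc' (negPart_nonneg _))
        (smul_nonneg hc' (posPart_nonneg _))
      rw [← smul_sub, ← neg_sub x⁺ x⁻, posPart_sub_negPart, smul_neg, neg_smul, neg_neg] at h
      rw [h, hsmul' _ _ hc' (posPart_nonneg _),
        hsmul' _ _ hc' (negPart_nonneg _)]
      simp only [neg_smul, RingHom.id_apply, smul_sub]
      abel
  · intro x hx
    simp [posPart_of_nonneg hx, negPart_of_nonneg hx, q0]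

end VectorLatticeModule

/-! ### Positive functionals -/

section Functionals

variable {E : Type*} [NormedAddCommGroup E] [NormedSpace ℝ E] [Lattice E] [IsOrderedAddMonoid E]
  [IsOrderedModule ℝ E] [HasSolidNorm E]

theorem norm_le_norm_of_le {a b : E} (ha : 0 ≤ a) (h : a ≤ b) : ‖a‖ ≤ ‖b‖ :=
  norm_le_norm_of_abs_le_abs (by rwa [abs_of_nonneg ha, abs_of_nonneg (ha.trans h)])

/-- Positive functionals. -/
def IsPositive (f : StrongDual ℝ E) : Prop := ∀ x, 0 ≤ x → 0 ≤ f x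

theorem IsPositive.mono {f : StrongDual ℝ E} (hf : IsPositive f) {a b : E} (h : a ≤ b) :
    f a ≤ f b := by
  have := hf _ (sub_nonneg.2 h)
  rw [map_sub] at this
  linarith

/-- Subhomogeneity suffices: applied to `c⁻¹` and `c • x` it yields the reverse inequality. -/
theorem exists_isPositive_eq_on_cone (q : E → ℝ) {C : ℝ} (hC : 0 ≤ C)
    (hadd : ∀ x y, 0 ≤ x → 0 ≤ y → q (x + y) = q x + q y)
    (hsmul : ∀ (c : ℝ) x, 0 < c → 0 ≤ x → q (c • x) ≤ c * q x)
    (h0 : ∀ x, 0 ≤ x → 0 ≤ q x) (hq : ∀ x, 0 ≤ x → q x ≤ C * ‖x‖) :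
    ∃ f : StrongDual ℝ E, IsPositive f ∧ ‖f‖ ≤ C ∧ ∀ x, 0 ≤ x → f x = q x := by
  obtain ⟨L, hL⟩ := exists_linearMap_eq_on_cone q hadd (by
    intro c x hc hx
    refine le_antisymm (hsmul c x hc hx) ?_
    have h := hsmul c⁻¹ (c • x) (inv_pos.2 hc) (smul_nonneg hc.le hx)
    rw [inv_smul_smul₀ hc.ne', le_inv_mul_iff₀ hc] at h
    exact h)
  have hmono : ∀ {a b : E}, a ≤ b → L a ≤ L b := by
    intro a b h
    have := h0 _ (sub_nonneg.2 h)
    rw [← hL _ (sub_nonneg.2 h), map_sub] at this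
    linarith
  have hbd : ∀ x, ‖L x‖ ≤ C * ‖x‖ := by
    intro x
    have h1 : |L x| ≤ L |x| :=
      abs_le.2 ⟨by rw [neg_le, ← map_neg]; exact hmono (neg_le_abs x), hmono (le_abs_self x)⟩
    have h2 := hq |x| (abs_nonneg x)
    rw [norm_abs_eq_norm, ← hL _ (abs_nonneg x)] at h2
    exact h1.trans h2
  refine ⟨L.mkContinuous C hbd, ?_, L.mkContinuous_norm_le hC hbd, fun x hx => hL x hx⟩
  intro x hx
  exact (h0 x hx).trans (hL x hx).ge

/-- The modulus of a functional, given by the Riesz–Kantorovich formula. -/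
theorem exists_modulus (f : StrongDual ℝ E) :
    ∃ p : StrongDual ℝ E, IsPositive p ∧ ‖p‖ ≤ ‖f‖ ∧ (∀ y, |f y| ≤ p |y|) ∧
      ∀ x, 0 ≤ x → ∀ η > 0, ∃ y, |y| ≤ x ∧ p x - η < f y := by
  set S : E → Set ℝ := fun x => f '' {y | |y| ≤ x} with hS
  have hbdd : ∀ x, ∀ r ∈ S x, r ≤ ‖f‖ * ‖x‖ := by
    rintro x _ ⟨y, hy, rfl⟩
    refine (le_abs_self _).trans ((f.le_opNorm y).trans ?_)
    refine mul_le_mul_of_nonneg_left (norm_le_norm_of_abs_le_abs (le_trans hy (le_abs_self x)))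
      (norm_nonneg f)
  have hbdd' : ∀ x, BddAbove (S x) := fun x => ⟨_, hbdd x⟩
  have hne : ∀ x, 0 ≤ x → (0 : ℝ) ∈ S x := fun x hx => ⟨0, by simpa using hx, map_zero f⟩
  obtain ⟨p, hp, hpn, hpq⟩ := exists_isPositive_eq_on_cone (fun x => sSup (S x)) (norm_nonneg f)
    (by
      intro x y hx hy
      apply le_antisymm
      · refine csSup_le ⟨0, hne _ (add_nonneg hx hy)⟩ ?_
        rintro _ ⟨z, hz, rfl⟩
        obtain ⟨z₁, z₂, rfl, h1, h2⟩ := exists_add_of_abs_le_add hx hy hz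
        rw [map_add]
        exact add_le_add (le_csSup (hbdd' x) ⟨z₁, h1, rfl⟩) (le_csSup (hbdd' y) ⟨z₂, h2, rfl⟩)
      · rw [← le_sub_iff_add_le]
        refine csSup_le ⟨0, hne _ hx⟩ ?_
        rintro _ ⟨z, hz, rfl⟩
        rw [le_sub_comm]
        refine csSup_le ⟨0, hne _ hy⟩ ?_
        rintro _ ⟨w, hw, rfl⟩
        rw [le_sub_iff_add_le']
        exact le_csSup (hbdd' _) ⟨z + w, (abs_add_le z w).trans (add_le_add hz hw), map_add f z w⟩)
    (by
      intro c x hc hx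
      refine csSup_le ⟨0, hne _ (smul_nonneg hc.le hx)⟩ ?_
      rintro _ ⟨z, hz, rfl⟩
      rw [← inv_mul_le_iff₀ hc]
      refine le_csSup (hbdd' x) ⟨c⁻¹ • z, ?_, by simp⟩
      change |c⁻¹ • z| ≤ x
      rw [abs_smul_of_nonneg (inv_nonneg.2 hc.le), inv_smul_le_iff_of_pos hc]
      exact hz)
    (fun x hx => le_csSup (hbdd' x) (hne x hx))
    (fun x hx => csSup_le ⟨0, hne x hx⟩ (hbdd x))
  refine ⟨p, hp, hpn, ?_, ?_⟩
  · intro y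
    rw [hpq _ (abs_nonneg y)]
    refine abs_le'.2 ⟨le_csSup (hbdd' _) ⟨y, show |y| ≤ |y| from le_rfl, rfl⟩,
      le_csSup (hbdd' _) ⟨-y, show |-y| ≤ |y| by rw [abs_neg], map_neg f y⟩⟩
  · intro x hx η hη
    rw [hpq x hx]
    obtain ⟨_, ⟨y, hy, rfl⟩, h⟩ := exists_lt_of_lt_csSup ⟨0, hne x hx⟩ (sub_lt_self (sSup (S x)) hη)
    exact ⟨y, hy, h⟩

/-- The component of a positive functional carried by `y`. -/
theorem exists_localization {f : StrongDual ℝ E} (hf : IsPositive f) {y : E} (hy : 0 ≤ y) :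
    ∃ g : StrongDual ℝ E, IsPositive g ∧ ‖g‖ ≤ ‖f‖ ∧
      ∀ x, 0 ≤ x → Monotone (fun k : ℕ => f (x ⊓ k • y)) ∧
        Tendsto (fun k : ℕ => f (x ⊓ k • y)) atTop (𝓝 (g x)) := by
  have hmono : ∀ x, Monotone (fun k : ℕ => f (x ⊓ k • y)) := fun x k l hkl =>
    hf.mono (inf_le_inf_left x (nsmul_le_nsmul_left hy hkl))
  have hle : ∀ x, ∀ k : ℕ, f (x ⊓ k • y) ≤ f x := fun x k => hf.mono inf_le_left
  have hlim : ∀ x, Tendsto (fun k : ℕ => f (x ⊓ k • y)) atTop (𝓝 (⨆ k : ℕ, f (x ⊓ k • y))) :=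
    fun x => tendsto_atTop_ciSup (hmono x) ⟨f x, by rintro _ ⟨k, rfl⟩; exact hle x k⟩
  have hge : ∀ x, ∀ k : ℕ, f (x ⊓ k • y) ≤ ⨆ k : ℕ, f (x ⊓ k • y) :=
    fun x k => (hmono x).ge_of_tendsto (hlim x) k
  have hky : ∀ k : ℕ, 0 ≤ k • y := fun k => nsmul_nonneg hy k
  obtain ⟨g, hg, hgn, hgq⟩ := exists_isPositive_eq_on_cone
    (fun x => ⨆ k : ℕ, f (x ⊓ k • y)) (norm_nonneg f)
    (by
      intro x x' hx hx'
      apply le_antisymm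
      · refine ciSup_le fun k => ?_
        refine (hf.mono (add_inf_le hx hx' (hky k))).trans ?_
        rw [map_add]
        exact add_le_add (hge x k) (hge x' k)
      -- Superadditivity: `x ⊓ k • y + x' ⊓ k • y ≤ (x + x') ⊓ (2k) • y`.
      · refine le_of_tendsto ((hlim x).add (hlim x')) (Eventually.of_forall fun k => ?_)
        rw [← map_add]
        refine le_trans (hf.mono (le_inf ?_ ?_)) (hge (x + x') (k + k))
        · exact add_le_add inf_le_left inf_le_left
        · rw [add_nsmul]
          exact add_le_add inf_le_right inf_le_right)
    (by
      intro c x hc hx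
      refine ciSup_le fun k => ?_
      obtain ⟨m, hm⟩ := exists_nat_ge ((k : ℝ) / c)
      rw [div_le_iff₀' hc] at hm
      refine le_trans ?_ (mul_le_mul_of_nonneg_left (hge x m) hc.le)
      rw [← smul_eq_mul, ← map_smul, smul_inf_of_pos hc]
      refine hf.mono (inf_le_inf_left _ ?_)
      rw [← Nat.cast_smul_eq_nsmul ℝ, ← Nat.cast_smul_eq_nsmul ℝ, smul_smul]
      exact smul_le_smul_of_nonneg_right hm hy)
    (fun x hx => (hf _ (le_inf hx (hky 0))).trans (hge x 0))
    (fun x hx => ciSup_le fun k => (hle x k).trans ((le_abs_self _).trans (f.le_opNorm x)))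
  refine ⟨g, hg, hgn, fun x hx => ⟨hmono x, ?_⟩⟩
  rw [hgq x hx]
  exact hlim x

/-- A norm-one positive functional attaining the norm at a positive element. -/
theorem exists_isPositive_norming {y : E} (hy : 0 ≤ y) :
    ∃ f : StrongDual ℝ E, IsPositive f ∧ ‖f‖ ≤ 1 ∧ f y = ‖y‖ := by
  rcases eq_or_ne y 0 with rfl | hy0
  · exact ⟨0, fun x _ => le_rfl, by simp, by simp⟩
  -- Domination by `‖x⁺‖` rather than `‖x‖` makes the Hahn–Banach extension positive, as `(-x)⁺ = 0`
  -- for `x ≥ 0`.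
  obtain ⟨g, hg1, hg2⟩ := exists_extension_of_le_sublinear
    (LinearPMap.mkSpanSingleton (K := ℝ) y ‖y‖ hy0) (fun x => ‖x⁺‖)
    (by
      intro c hc x
      have : (c • x)⁺ = c • x⁺ := by
        rw [posPart_def, posPart_def, smul_sup_of_pos hc, smul_zero]
      rw [this, norm_smul, Real.norm_of_nonneg hc.le])
    (by
      intro a b
      refine le_trans (norm_le_norm_of_le (posPart_nonneg _) ?_) (norm_add_le _ _)
      rw [posPart_def]
      exact sup_le (add_le_add (le_posPart a) (le_posPart b))
        (add_nonneg (posPart_nonneg a) (posPart_nonneg b)))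
    (by
      rintro ⟨x, hx⟩
      obtain ⟨c, rfl⟩ := Submodule.mem_span_singleton.1 hx
      refine (LinearPMap.mkSpanSingleton'_apply y ‖y‖ _ c hx).le.trans ?_
      change c * ‖y‖ ≤ ‖(c • y)⁺‖
      rcases le_total c 0 with hc | hc
      · exact (mul_nonpos_of_nonpos_of_nonneg hc (norm_nonneg y)).trans (norm_nonneg _)
      · rw [posPart_of_nonneg (smul_nonneg hc hy), norm_smul, Real.norm_of_nonneg hc])
  have hle : ∀ x, g x ≤ ‖x‖ := fun x => (hg2 x).trans (norm_le_norm_of_abs_le_abs (by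
    rw [abs_of_nonneg (posPart_nonneg x), posPart_def]
    exact sup_le (le_abs_self x) (abs_nonneg x)))
  have hbd : ∀ x, ‖g x‖ ≤ 1 * ‖x‖ := fun x => by
    rw [one_mul]
    refine abs_le'.2 ⟨hle x, ?_⟩
    have := hle (-x)
    rwa [map_neg, norm_neg] at this
  refine ⟨g.mkContinuous 1 hbd, ?_, g.mkContinuous_norm_le zero_le_one hbd, ?_⟩
  · intro x hx
    have := hg2 (-x)
    rw [posPart_of_nonpos (neg_nonpos.2 hx), norm_zero, map_neg] at this
    exact neg_nonpos.1 this
  · have h1 := hg1 ⟨y, Submodule.mem_span_singleton_self y⟩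
    exact h1.trans (LinearPMap.mkSpanSingleton_apply ℝ ℝ hy0 ‖y‖)

end Functionals

/-- Banach–Alaoglu; the ultrafilter replaces a weak* convergent subsequence, which need not exist.
-/
theorem exists_weakStar_ultrafilter_limit {X : Type*} [NormedAddCommGroup X] [NormedSpace ℝ X]
    {f : ℕ → StrongDual ℝ X} {M : ℝ} (hf : ∀ n, ‖f n‖ ≤ M) (U : Ultrafilter ℕ) :
    ∃ g : StrongDual ℝ X, ∀ x, Tendsto (fun n => f n x) U (𝓝 (g x)) := by
  have hK := WeakDual.isCompact_closedBall (𝕜 := ℝ) (E := X) 0 M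
  obtain ⟨g, -, hg⟩ := hK.ultrafilter_le_nhds (U.map fun n => StrongDual.toWeakDual (f n)) (by
    rw [le_principal_iff]
    refine Filter.mem_map.2 (Filter.univ_mem' fun n => ?_)
    simpa using hf n)
  exact ⟨WeakDual.toStrongDual g, fun x => ((WeakDual.eval_continuous x).tendsto g).comp hg⟩

/-! ### Disjointification -/

section Disjointification

variable {E : Type*} [NormedAddCommGroup E] [NormedSpace ℝ E] [Lattice E] [IsOrderedAddMonoid E]
  [IsOrderedModule ℝ E] [HasSolidNorm E]

theorem posPart_smul_of_pos {c : ℝ} (hc : 0 < c) (a : E) : (c • a)⁺ = c • a⁺ := by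
  rw [posPart_def, posPart_def, smul_sup_of_pos hc, smul_zero]

/-- Since `c' ≥ c⁻¹`, the second factor is at most `c⁻¹ • (c • b - a)⁺`, a multiple of the negative
part of `a - c • b`. -/
theorem posPart_sub_smul_inf_posPart_sub_smul {a b : E} {c c' : ℝ} (ha : 0 ≤ a) (hc : 0 < c)
    (hcc : 1 ≤ c * c') : (a - c • b)⁺ ⊓ (b - c' • a)⁺ = 0 := by
  have h1 : (b - c' • a)⁺ ≤ c⁻¹ • (c • b - a)⁺ := by
    rw [← posPart_smul_of_pos (inv_pos.2 hc), smul_sub, inv_smul_smul₀ hc.ne']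
    refine posPart_mono (sub_le_sub_left (smul_le_smul_of_nonneg_right ?_ ha) _)
    rwa [inv_le_iff_one_le_mul₀' hc]
  refine inf_eq_zero_of_le (posPart_nonneg _) (posPart_nonneg _) (one_smul ℝ _).ge h1 ?_
  exact smul_inf_smul_eq_zero (posPart_nonneg _) (posPart_nonneg _)
    (sup_sub_inf_sup_sub a (c • b)) zero_le_one (inv_nonneg.2 hc.le)

/-- An order bounded positive weakly null sequence that is not killed by bounded positive
functionals has a disjoint minorant along a subsequence that is not killed either. -/
theorem exists_disjoint_minorant {d : ℕ → E} {u : E} (hd0 : ∀ n, 0 ≤ d n) (hdu : ∀ n, d n ≤ u)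
    {f : ℕ → StrongDual ℝ E} (hf : ∀ n, IsPositive (f n)) {M : ℝ} (hM : ∀ n, ‖f n‖ ≤ M)
    (hw : ∀ g : StrongDual ℝ E, IsPositive g → Tendsto (fun n => g (d n)) atTop (𝓝 0))
    {ε : ℝ} (hε : 0 < ε) (hfd : ∀ n, ε ≤ f n (d n)) :
    ∃ s : ℕ → ℕ, StrictMono s ∧ ∃ y : ℕ → E, (∀ k, 0 ≤ y k) ∧ (∀ k, y k ≤ d (s k)) ∧
      (∀ j k, j ≠ k → y j ⊓ y k = 0) ∧ ∀ k, ε / 2 ≤ f (s k) (y k) := by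
  obtain ⟨g, hg⟩ := exists_weakStar_ultrafilter_limit hM (hyperfilter ℕ)
  have hgpos : IsPositive g := fun x hx =>
    ge_of_tendsto (hg x) (Eventually.of_forall fun n => hf n x hx)
  have hM0 : 0 ≤ M := (norm_nonneg _).trans (hM 0)
  have hu0 : 0 ≤ u := (hd0 0).trans (hdu 0)
  -- The loss `ε / 2` is split evenly: `C` makes the `u` correction cost at most `ε / 4`, and `c`
  -- below does so for the earlier terms.
  set C : ℝ := 4 * (M * ‖u‖) / ε + 1 with hC
  have hC0 : 0 < C := by positivity
  have hfu : ∀ n, C⁻¹ * f n u ≤ ε / 4 := by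
    intro n
    rw [inv_mul_le_iff₀ hC0]
    have h1 : f n u ≤ M * ‖u‖ := (le_abs_self _).trans
      (((f n).le_opNorm u).trans (mul_le_mul_of_nonneg_right (hM n) (norm_nonneg u)))
    have h2 : C * (ε / 4) = M * ‖u‖ + ε / 4 := by
      rw [hC]; field_simp
    linarith
  set c : ℝ := ε / (8 * C) with hc
  have hc0 : 0 < c := by positivity
  -- The second coordinate is the chosen index, the first only sets the tolerance. Smallness of the
  -- limit `g` on `d p.2` lets later `f n` be small there too.
  obtain ⟨a, haP, har⟩ := exists_seq_of_forall_finset_exists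
    (fun p : ℕ × ℕ => g (d p.2) < c * (1 / 2) ^ p.1)
    (fun p q : ℕ × ℕ => p.1 < q.1 ∧ p.2 < q.2 ∧ f q.2 (d p.2) < c * (1 / 2) ^ p.1)
    (by
      intro S hS
      have h1 : ∀ᶠ n in (hyperfilter ℕ : Filter ℕ),
          ∀ p ∈ S, p.2 < n ∧ f n (d p.2) < c * (1 / 2) ^ p.1 := by
        refine (eventually_all_finset S).2 fun p hp => ?_
        exact (Eventually.filter_mono Nat.hyperfilter_le_atTop (eventually_gt_atTop p.2)).and
          ((hg (d p.2)).eventually_lt_const (hS p hp))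
      have h2 : ∀ᶠ n in (hyperfilter ℕ : Filter ℕ),
          g (d n) < c * (1 / 2) ^ (S.sup Prod.fst + 1) :=
        Nat.hyperfilter_le_atTop ((hw g hgpos).eventually_lt_const (by positivity))
      obtain ⟨n, hn1, hn2⟩ := (h1.and h2).exists
      exact ⟨(S.sup Prod.fst + 1, n), hn2, fun p hp =>
        ⟨Nat.lt_succ_of_le (Finset.le_sup (f := Prod.fst) hp), hn1 p hp⟩⟩)
  have hk : StrictMono fun i => (a i).1 := fun i j hij => (har i j hij).1
  have hs : StrictMono fun i => (a i).2 := fun i j hij => (har i j hij).2.1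
  have hsmall : ∀ i j, i < j → f (a j).2 (d (a i).2) ≤ c * (1 / 2) ^ i := by
    intro i j hij
    refine (har i j hij).2.2.le.trans (mul_le_mul_of_nonneg_left ?_ hc0.le)
    exact pow_le_pow_of_le_one (by norm_num) (by norm_num) (hk.le_apply)
  -- Subtracting `C` times the earlier terms separates `w j` from them; subtracting `C⁻¹ • u`, which
  -- dominates every `C⁻¹ • d n`, separates it from all later ones.
  set w : ℕ → E := fun j =>
    d (a j).2 - C • ∑ i ∈ Finset.range j, d (a i).2 - C⁻¹ • u with hwdef
  have hCu : 0 ≤ C⁻¹ • u := smul_nonneg (by positivity) hu0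
  have hsum0 : ∀ j, 0 ≤ C • ∑ i ∈ Finset.range j, d (a i).2 := fun j =>
    smul_nonneg hC0.le (Finset.sum_nonneg fun i _ => hd0 _)
  have hdis : ∀ i j, i < j → (w i)⁺ ⊓ (w j)⁺ = 0 := by
    intro i j hij
    rw [inf_comm]
    refine inf_eq_zero_of_le (posPart_nonneg _) (posPart_nonneg _)
      (posPart_mono (?_ : w j ≤ d (a j).2 - C • d (a i).2))
      (posPart_mono (?_ : w i ≤ d (a i).2 - C⁻¹ • d (a j).2))
      (posPart_sub_smul_inf_posPart_sub_smul (hd0 _) hC0 (mul_inv_cancel₀ hC0.ne').ge)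
    · refine (sub_le_self _ hCu).trans (sub_le_sub_left (smul_le_smul_of_nonneg_left ?_ hC0.le) _)
      exact Finset.single_le_sum (f := fun i => d (a i).2) (fun i _ => hd0 _)
        (Finset.mem_range.2 hij)
    · exact sub_le_sub (sub_le_self _ (hsum0 i))
        (smul_le_smul_of_nonneg_left (hdu _) (by positivity))
  refine ⟨fun i => (a i).2, hs, fun j => (w j)⁺, fun j => posPart_nonneg _, fun j => ?_, ?_, ?_⟩
  · exact sup_le ((sub_le_self _ hCu).trans (sub_le_self _ (hsum0 j))) (hd0 _)
  · intro i j hij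
    rcases lt_or_gt_of_ne hij with h | h
    · exact hdis i j h
    · rw [inf_comm]; exact hdis j i h
  · intro j
    refine le_trans ?_ ((hf _).mono (le_posPart (w j)))
    have h1 : f (a j).2 (w j) = f (a j).2 (d (a j).2)
        - C * ∑ i ∈ Finset.range j, f (a j).2 (d (a i).2) - C⁻¹ * f (a j).2 u := by
      simp [hwdef]
    have h2 : ∑ i ∈ Finset.range j, f (a j).2 (d (a i).2) ≤ c * 2 := by
      refine (Finset.sum_le_sum fun i hi => hsmall i j (Finset.mem_range.1 hi)).trans ?_
      rw [← Finset.mul_sum]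
      exact mul_le_mul_of_nonneg_left (sum_geometric_two_le j) hc0.le
    have h3 : C * (c * 2) = ε / 4 := by
      rw [hc]; field_simp; norm_num
    have h4 := mul_le_mul_of_nonneg_left h2 hC0.le
    have h5 := hfd (a j).2
    have h6 := hfu (a j).2
    rw [h1]
    linarith

end Disjointification

theorem exists_strictMono_le_of_not_tendsto {a : ℕ → ℝ} (ha : ∀ n, 0 ≤ a n)
    (h : ¬ Tendsto a atTop (𝓝 0)) : ∃ ε > 0, ∃ φ : ℕ → ℕ, StrictMono φ ∧ ∀ n, ε ≤ a (φ n) := by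
  rw [Metric.tendsto_atTop] at h
  push Not at h
  obtain ⟨ε, hε, h⟩ := h
  obtain ⟨φ, hφ, hφ'⟩ := extraction_of_frequently_atTop
    (P := fun n => ε ≤ a n) (frequently_atTop.2 fun N => by
      obtain ⟨n, hn, hn'⟩ := h N
      rw [Real.dist_eq, sub_zero, abs_of_nonneg (ha n)] at hn'
      exact ⟨n, hn, hn'⟩)
  exact ⟨ε, hε, φ, hφ, hφ'⟩

theorem weaklyNull_iff {X : Type*} [NormedAddCommGroup X] [NormedSpace ℝ X] {x : ℕ → X} :
    WeaklyNull x ↔ ∀ f : StrongDual ℝ X, Tendsto (fun n => f (x n)) atTop (𝓝 0) := by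
  have hinj : Function.Injective (topDualPairing ℝ X).flip := by
    intro a b hab
    refine eq_of_sub_eq_zero (SeparatingDual.eq_zero_of_forall_dual_eq_zero (R := ℝ) fun f => ?_)
    rw [map_sub, sub_eq_zero]
    exact congrArg (fun F => F f) hab
  refine (WeakBilin.tendsto_iff_forall_eval_tendsto (topDualPairing ℝ X).flip hinj).trans ?_
  refine forall_congr' fun f => ?_
  have : ((topDualPairing ℝ X).flip (0 : X)) f = 0 := by simp
  change Tendsto _ _ (𝓝 (((topDualPairing ℝ X).flip (0 : X)) f)) ↔ _
  rw [this]
  rfl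

theorem weakStarNull_iff {X : Type*} [NormedAddCommGroup X] [NormedSpace ℝ X]
    {f : ℕ → StrongDual ℝ X} :
    WeakStarNull f ↔ ∀ x, Tendsto (fun n => f n x) atTop (𝓝 0) :=
  tendsto_iff_forall_eval_tendsto_topDualPairing

/-! ### Functionals carried by disjoint elements; almost limited sets -/

section

variable {E : Type*} [NormedAddCommGroup E] [NormedSpace ℝ E] [Lattice E] [IsOrderedAddMonoid E]
  [IsOrderedModule ℝ E] [HasSolidNorm E]

/-- Order bounded disjoint sequences of positive elements are norm null. -/
def DisjointBoundedNull (E : Type*) [NormedAddCommGroup E] [Lattice E] : Prop :=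
  ∀ (u : E) (y : ℕ → E), (∀ n, 0 ≤ y n) → (∀ n, y n ≤ u) → (∀ m n, m ≠ n → y m ⊓ y n = 0) →
    Tendsto (fun n => ‖y n‖) atTop (𝓝 0)

/-- The partial sums have a supremum `s`; then `s - S N ↓ 0` and `y N ≤ s - S N`. -/
theorem HasOrderContinuousNorm.disjointBoundedNull (hE : SigmaDedekindComplete E)
    (hoc : HasOrderContinuousNorm E) : DisjointBoundedNull E := by
  intro u y h0 hu hd
  set S : ℕ → E := fun N => ∑ n ∈ Finset.range N, y n with hS
  have hSm : Monotone S := fun M N h =>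
    Finset.sum_le_sum_of_subset_of_nonneg (Finset.range_mono h) fun n _ _ => h0 n
  have hSu : ∀ N, S N ≤ u := fun N => sum_le_of_disjoint (fun n _ => h0 n)
    ((h0 0).trans (hu 0)) (fun n _ => hu n) fun m _ n _ h => hd m n h
  obtain ⟨s, hs⟩ := hE (range S) (countable_range S) (range_nonempty S)
    ⟨u, by rintro _ ⟨N, rfl⟩; exact hSu N⟩
  -- `ULift` moves the index set into the universe of `E`.
  have hlim := hoc (ULift ℕ) (fun i => s - S i.down) (fun i j h => sub_le_sub_left (hSm h) s) (by
    constructor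
    · rintro _ ⟨i, rfl⟩
      exact sub_nonneg.2 (hs.1 ⟨i.down, rfl⟩)
    · intro b hb
      have : s ≤ s - b := hs.2 (by
        rintro _ ⟨N, rfl⟩
        exact le_sub_comm.1 (hb ⟨⟨N⟩, rfl⟩))
      simpa using this)
  have hlim' : Tendsto (fun N => ‖s - S N‖) atTop (𝓝 0) :=
    hlim.comp (tendsto_atTop.2 fun b => (eventually_ge_atTop b.down).mono fun _ h => h :
      Tendsto (ULift.up : ℕ → ULift ℕ) atTop atTop)
  refine squeeze_zero (fun _ => norm_nonneg _) (fun N => norm_le_norm_of_le (h0 N) ?_) hlim'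
  rw [le_sub_iff_add_le', ← Finset.sum_range_succ]
  exact hs.1 ⟨N + 1, rfl⟩

/-- Otherwise norming functionals and `exists_disjoint_minorant` produce an order bounded disjoint
sequence with norms at least `ε / 2`. -/
theorem DisjointBoundedNull.tendsto_norm (hE : DisjointBoundedNull E) {z : ℕ → E} {u : E}
    (h0 : ∀ n, 0 ≤ z n) (hu : ∀ n, z n ≤ u)
    (hw : ∀ g : StrongDual ℝ E, IsPositive g → Tendsto (fun n => g (z n)) atTop (𝓝 0)) :
    Tendsto (fun n => ‖z n‖) atTop (𝓝 0) := by
  by_contra hcon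
  obtain ⟨ε, hε, φ, hφ, h⟩ := exists_strictMono_le_of_not_tendsto (fun n => norm_nonneg (z n)) hcon
  choose f hf hf1 hfz using fun n => exists_isPositive_norming (h0 (φ n))
  obtain ⟨s, -, y, hy0, hyz, hyd, hfy⟩ := exists_disjoint_minorant (fun n => h0 (φ n))
    (fun n => hu (φ n)) hf hf1 (fun g hg => (hw g hg).comp hφ.tendsto_atTop) hε
    (fun n => (h n).trans (hfz n).ge)
  have hlim := hE u y hy0 (fun k => (hyz k).trans (hu _)) hyd
  have := ge_of_tendsto hlim (Eventually.of_forall fun k => (hfy k).trans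
    ((le_abs_self _).trans (((f (s k)).le_opNorm (y k)).trans
      ((mul_le_mul_of_nonneg_right (hf1 _) (norm_nonneg _)).trans (one_mul _).le))))
  linarith

/-- `g` is carried by the band generated by `y`. -/
def IsCarriedBy (g : StrongDual ℝ E) (y : E) : Prop :=
  ∀ x, 0 ≤ x → Tendsto (fun k : ℕ => g (x ⊓ k • y)) atTop (𝓝 (g x))

theorem nsmul_inf_eq_zero {x y : E} (hx : 0 ≤ x) (hy : 0 ≤ y) (h : x ⊓ y = 0) (k : ℕ) :
    x ⊓ k • y = 0 := by
  have := smul_inf_smul_eq_zero hx hy h zero_le_one (Nat.cast_nonneg k)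
  rwa [one_smul, Nat.cast_smul_eq_nsmul] at this

theorem IsCarriedBy.eq_zero {g : StrongDual ℝ E} {x y : E} (hg : IsCarriedBy g y) (hx : 0 ≤ x)
    (hy : 0 ≤ y) (h : x ⊓ y = 0) : g x = 0 := by
  refine tendsto_nhds_unique (hg x hx) ?_
  simp [nsmul_inf_eq_zero hx hy h]

theorem IsCarriedBy.mono {g : StrongDual ℝ E} {y z : E} (hg : IsCarriedBy g y)
    (hpos : IsPositive g) (h : y ≤ z) : IsCarriedBy g z := fun x hx =>
  tendsto_of_tendsto_of_tendsto_of_le_of_le (hg x hx) tendsto_const_nhds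
    (fun k => hpos.mono (inf_le_inf_left x (nsmul_le_nsmul_right h k)))
    (fun _ => hpos.mono inf_le_left)

/-- The localization agrees with `f` below multiples of `y`, so localizing again changes nothing. -/
theorem exists_isCarriedBy {f : StrongDual ℝ E} (hf : IsPositive f) {y : E} (hy : 0 ≤ y) :
    ∃ g : StrongDual ℝ E, IsPositive g ∧ ‖g‖ ≤ ‖f‖ ∧ IsCarriedBy g y ∧ g y = f y := by
  obtain ⟨g, hg, hgn, h⟩ := exists_localization hf hy
  have key : ∀ k : ℕ, ∀ x, 0 ≤ x → x ≤ k • y → g x = f x := by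
    intro k x hx hxk
    refine tendsto_nhds_unique (h x hx).2 (tendsto_const_nhds.congr' ?_)
    filter_upwards [eventually_ge_atTop k] with l hl
    rw [inf_eq_left.2 (hxk.trans (nsmul_le_nsmul_left hy hl))]
  refine ⟨g, hg, hgn, fun x hx => (h x hx).2.congr fun k => ?_, key 1 y hy (by simp)⟩
  exact (key k _ (le_inf hx (nsmul_nonneg hy k)) inf_le_right).symm

theorem isDualAbs_self {g : StrongDual ℝ E} (hg : IsPositive g) : IsDualAbs g g :=
  ⟨fun _ _ => le_rfl, fun x hx => by
    have := hg x hx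
    change -g x ≤ g x
    linarith, fun _ h _ => h⟩

/-- Split `x` at `x ⊓ n • y`: `h` vanishes on this piece and `g` is small on the remainder, so a
common lower bound is at most 0 at `x`. -/
theorem IsCarriedBy.dualDisjoint {g h : StrongDual ℝ E} {y z : E} (hg : IsPositive g)
    (hh : IsPositive h) (hgy : IsCarriedBy g y) (hhz : IsCarriedBy h z) (hy : 0 ≤ y) (hz : 0 ≤ z)
    (hyz : y ⊓ z = 0) : DualDisjoint g h := by
  refine ⟨g, h, isDualAbs_self hg, isDualAbs_self hh, hg, hh, ?_⟩
  intro k hkg hkh x hx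
  have h1 : Tendsto (fun n : ℕ => g x - g (x ⊓ n • y)) atTop (𝓝 0) := by
    simpa using (tendsto_const_nhds (x := g x)).sub (hgy x hx)
  refine ge_of_tendsto h1 (Eventually.of_forall fun n => ?_)
  have hn : 0 ≤ x ⊓ n • y := le_inf hx (nsmul_nonneg hy n)
  have h2 : h (x ⊓ n • y) = 0 := hhz.eq_zero hn hz (by
    refine inf_eq_zero_of_le hn hz inf_le_right le_rfl ?_
    rw [inf_comm]
    exact nsmul_inf_eq_zero hz hy (by rwa [inf_comm]) n)
  have h3 := hkh _ hn
  have h4 := hkg (x - x ⊓ n • y) (sub_nonneg.2 inf_le_left)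
  rw [map_sub, map_sub] at h4
  linarith

/-- For `x ≥ 0`, `g n x` is nearly `g n (x ⊓ k n • y n)`, and these truncations are disjoint and
below `x`. -/
theorem weakStarNull_of_isCarriedBy (hE : DisjointBoundedNull E) {g : ℕ → StrongDual ℝ E}
    {y : ℕ → E} (hg : ∀ n, IsPositive (g n)) (hg1 : ∀ n, ‖g n‖ ≤ 1)
    (hgy : ∀ n, IsCarriedBy (g n) (y n)) (hy : ∀ n, 0 ≤ y n)
    (hd : ∀ m n, m ≠ n → y m ⊓ y n = 0) : WeakStarNull g := by
  have key : ∀ x, 0 ≤ x → Tendsto (fun n => g n x) atTop (𝓝 0) := by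
    intro x hx
    have hex : ∀ n : ℕ, ∃ k : ℕ, g n x - 1 / ((n : ℝ) + 1) < g n (x ⊓ k • y n) := fun n =>
      ((hgy n x hx).eventually_const_lt (sub_lt_self _ (by positivity))).exists
    choose k hk using hex
    have h1 := hE x (fun n => x ⊓ k n • y n) (fun n => le_inf hx (nsmul_nonneg (hy n) _))
      (fun n => inf_le_left) (fun m n hmn => by
        have h2 := nsmul_inf_eq_zero (hy m) (hy n) (hd m n hmn) (k n)
        rw [inf_comm] at h2
        have h3 := nsmul_inf_eq_zero (nsmul_nonneg (hy n) _) (hy m) h2 (k m)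
        rw [inf_comm] at h3
        exact inf_eq_zero_of_le (le_inf hx (nsmul_nonneg (hy m) _))
          (le_inf hx (nsmul_nonneg (hy n) _)) inf_le_right inf_le_right h3)
    have h4 := h1.add (tendsto_one_div_add_atTop_nhds_zero_nat (𝕜 := ℝ))
    rw [add_zero] at h4
    refine squeeze_zero (fun n => hg n x hx) (fun n => ?_) h4
    have h5 : g n (x ⊓ k n • y n) ≤ ‖x ⊓ k n • y n‖ := (le_abs_self _).trans
      (((g n).le_opNorm _).trans
        ((mul_le_mul_of_nonneg_right (hg1 n) (norm_nonneg _)).trans (one_mul _).le))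
    linarith [hk n]
  refine weakStarNull_iff.2 fun x => ?_
  have := (key x⁺ (posPart_nonneg x)).sub (key x⁻ (negPart_nonneg x))
  simpa [← map_sub] using this

/-- One of `y ⊓ a⁺`, `y ⊓ a⁻` has at least half the norm of `y`; a norming functional localized
there kills the other part of `a`. -/
theorem exists_isCarriedBy_le_abs {a y : E} (hy : 0 ≤ y) (hya : y ≤ |a|) :
    ∃ g : StrongDual ℝ E, IsPositive g ∧ ‖g‖ ≤ 1 ∧ IsCarriedBy g y ∧ ‖y‖ / 2 ≤ |g a| := by
  have key : ∀ b : E, ‖y‖ / 2 ≤ ‖y ⊓ b⁺‖ →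
      ∃ g : StrongDual ℝ E, IsPositive g ∧ ‖g‖ ≤ 1 ∧ IsCarriedBy g y ∧ ‖y‖ / 2 ≤ |g b| := by
    intro b hb
    have h0 : 0 ≤ y ⊓ b⁺ := le_inf hy (posPart_nonneg b)
    obtain ⟨f, hf, hf1, hfy⟩ := exists_isPositive_norming h0
    obtain ⟨g, hg, hgn, hgc, hgy⟩ := exists_isCarriedBy hf h0
    refine ⟨g, hg, hgn.trans hf1, hgc.mono hg inf_le_left, ?_⟩
    have h1 : g b⁻ = 0 := hgc.eq_zero (negPart_nonneg b) h0
      (inf_eq_zero_of_le (negPart_nonneg b) h0 le_rfl inf_le_right (by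
        rw [inf_comm]; exact posPart_inf_negPart_eq_zero b))
    have h2 : g b = g b⁺ := by
      conv_lhs => rw [← posPart_sub_negPart b]
      rw [map_sub, h1, sub_zero]
    rw [h2]
    refine (hb.trans ?_).trans (le_abs_self _)
    rw [← hfy, ← hgy]
    exact hg.mono inf_le_right
  have hsum : ‖y‖ ≤ ‖y ⊓ a⁺‖ + ‖y ⊓ a⁻‖ := by
    refine (norm_le_norm_of_le hy ?_).trans (norm_add_le _ _)
    have := add_inf_le (posPart_nonneg a) (negPart_nonneg a) hy
    rw [posPart_add_negPart, inf_eq_right.2 hya] at this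
    rwa [inf_comm y, inf_comm y]
  rcases le_total (‖y‖ / 2) ‖y ⊓ a⁺‖ with h | h
  · exact key a h
  · obtain ⟨g, h1, h2, h3, h4⟩ := key (-a) (by rw [posPart_neg]; linarith)
    exact ⟨g, h1, h2, h3, by rwa [map_neg, abs_neg] at h4⟩

theorem AlmostLimited.tendsto_norm (hE : DisjointBoundedNull E) {A : Set E} (hA : AlmostLimited A)
    {a y : ℕ → E} (ha : ∀ n, a n ∈ A) (hy : ∀ n, 0 ≤ y n) (hya : ∀ n, y n ≤ |a n|)
    (hd : ∀ m n, m ≠ n → y m ⊓ y n = 0) : Tendsto (fun n => ‖y n‖) atTop (𝓝 0) := by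
  choose g hg hg1 hgc hgy using fun n => exists_isCarriedBy_le_abs (hy n) (hya n)
  have h := hA.2 g (fun m n hmn => (hgc m).dualDisjoint (hg m) (hg n) (hgc n) (hy m) (hy n)
    (hd m n hmn)) (weakStarNull_of_isCarriedBy hE hg hg1 hgc hy hd)
  rw [Metric.tendstoUniformlyOn_iff] at h
  rw [Metric.tendsto_nhds]
  intro ε hε
  filter_upwards [h (ε / 2) (by positivity)] with n hn
  have h1 := hn (a n) (ha n)
  rw [dist_comm, Real.dist_eq, sub_zero] at h1
  rw [Real.dist_eq, sub_zero, abs_of_nonneg (norm_nonneg _)]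
  linarith [hgy n]

/-- A bounded set all of whose disjoint minorants are norm null is almost order bounded. -/
theorem exists_almost_order_bound [CompleteSpace E] {A : Set E} (hA : Bornology.IsBounded A)
    (h : ∀ a y : ℕ → E, (∀ n, a n ∈ A) → (∀ n, 0 ≤ y n) → (∀ n, y n ≤ |a n|) →
      (∀ m n, m ≠ n → y m ⊓ y n = 0) → Tendsto (fun n => ‖y n‖) atTop (𝓝 0))
    {ε : ℝ} (hε : 0 < ε) : ∃ u : E, 0 ≤ u ∧ ∀ a ∈ A, ‖(|a| - u)⁺‖ ≤ ε := by
  by_contra! hcon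
  obtain ⟨B, hB⟩ := hA.exists_norm_le
  choose! F hFA hF using hcon
  -- Greedy choice: `S n` is the sum of the earlier `|a m|`, and `a n` escapes `4 ^ n • S n`.
  let S : ℕ → E := fun n => Nat.rec 0 (fun n s => s + |F ((4 : ℝ) ^ n • s)|) n
  let a : ℕ → E := fun n => F ((4 : ℝ) ^ n • S n)
  have hSsucc : ∀ n, S (n + 1) = S n + |a n| := fun n => rfl
  have hS0 : ∀ n, 0 ≤ S n := by
    intro n
    induction n with
    | zero => exact le_rfl
    | succ n ih => rw [hSsucc]; exact add_nonneg ih (abs_nonneg _)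
  have hSm : Monotone S := monotone_nat_of_le_succ fun n => by
    rw [hSsucc]; exact le_add_of_nonneg_right (abs_nonneg _)
  have h4S : ∀ n, 0 ≤ (4 : ℝ) ^ n • S n := fun n => smul_nonneg (by positivity) (hS0 n)
  have haA : ∀ n, a n ∈ A := fun n => hFA _ (h4S n)
  have haF : ∀ n, ε < ‖(|a n| - (4 : ℝ) ^ n • S n)⁺‖ := fun n => hF _ (h4S n)
  have haS : ∀ m n, m < n → |a m| ≤ S n := fun m n hmn =>
    ((le_add_of_nonneg_left (hS0 m)).trans (hSsucc m).ge).trans (hSm hmn)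
  have hsum : Summable fun n => ((1 / 2 : ℝ) ^ n) • |a n| := by
    refine Summable.of_norm_bounded (g := fun n => B * (1 / 2 : ℝ) ^ n)
      (summable_geometric_two.mul_left B) fun n => ?_
    rw [norm_smul, norm_abs_eq_norm, Real.norm_of_nonneg (by positivity), mul_comm]
    exact mul_le_mul_of_nonneg_right (hB _ (haA n)) (by positivity)
  set w := ∑' n, ((1 / 2 : ℝ) ^ n) • |a n| with hw
  have hterm : ∀ n, 0 ≤ ((1 / 2 : ℝ) ^ n) • |a n| := fun n =>
    smul_nonneg (by positivity) (abs_nonneg _)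
  have hle : ∀ n, ((1 / 2 : ℝ) ^ n) • |a n| ≤ w := fun n => hsum.le_tsum n fun m _ => hterm m
  have hw0 : 0 ≤ w := (hterm 0).trans (hle 0)
  have hw' : ∀ n, 0 ≤ ((1 / 2 : ℝ) ^ n) • w := fun n => smul_nonneg (by positivity) hw0
  -- The correction by `w` handles later terms, since `2⁻ᵐ w ≥ 2⁻ᵐ 2⁻ⁿ |a n|` and `4ⁿ 2⁻ᵐ 2⁻ⁿ ≥ 1`
  -- for `m < n`; its norm tends to 0.
  set v : ℕ → E := fun n => |a n| - (4 : ℝ) ^ n • S n - ((1 / 2 : ℝ) ^ n) • w with hv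
  have hdis : ∀ m n, m < n → (v m)⁺ ⊓ (v n)⁺ = 0 := by
    intro m n hmn
    rw [inf_comm]
    refine inf_eq_zero_of_le (posPart_nonneg _) (posPart_nonneg _)
      (posPart_mono (?_ : v n ≤ |a n| - (4 : ℝ) ^ n • |a m|))
      (posPart_mono (?_ : v m ≤ |a m| - ((1 / 2 : ℝ) ^ m * (1 / 2 : ℝ) ^ n) • |a n|))
      (posPart_sub_smul_inf_posPart_sub_smul (abs_nonneg _) (by positivity) ?_)
    · exact (sub_le_self _ (hw' n)).trans
        (sub_le_sub_left (smul_le_smul_of_nonneg_left (haS m n hmn) (by positivity)) _)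
    · refine sub_le_sub (sub_le_self _ (h4S m)) ?_
      rw [mul_smul]
      exact smul_le_smul_of_nonneg_left (hle n) (by positivity)
    · have h1 : (4 : ℝ) ^ n = 2 ^ n * 2 ^ n := by rw [← mul_pow]; norm_num
      have h2 : (1 : ℝ) ≤ 2 ^ n * (1 / 2) ^ m := by
        rw [one_div, inv_pow, ← div_eq_mul_inv, one_le_div (by positivity)]
        exact pow_le_pow_right₀ (by norm_num) hmn.le
      have h3 : (2 : ℝ) ^ n * (1 / 2) ^ n = 1 := by rw [← mul_pow]; norm_num
      calc (1 : ℝ) ≤ 2 ^ n * (1 / 2) ^ m := h2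
        _ = (2 ^ n * (1 / 2) ^ m) * (2 ^ n * (1 / 2) ^ n) := by rw [h3, mul_one]
        _ = 4 ^ n * ((1 / 2) ^ m * (1 / 2) ^ n) := by rw [h1]; ring
  have hlim := h a (fun n => (v n)⁺) haA (fun n => posPart_nonneg _)
    (fun n => sup_le ((sub_le_self _ (hw' n)).trans (sub_le_self _ (h4S n))) (abs_nonneg _))
    (fun m n hmn => by
      rcases lt_or_gt_of_ne hmn with h | h
      · exact hdis m n h
      · rw [inf_comm]; exact hdis n m h)
  have hlim2 : Tendsto (fun n : ℕ => (1 / 2 : ℝ) ^ n * ‖w‖) atTop (𝓝 0) := by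
    simpa using (tendsto_pow_atTop_nhds_zero_of_lt_one (r := (1 / 2 : ℝ)) (by norm_num)
      (by norm_num)).mul_const ‖w‖
  have hlim3 := hlim.add hlim2
  rw [add_zero] at hlim3
  have := ge_of_tendsto hlim3 (b := ε) (Eventually.of_forall fun n => by
    refine (haF n).le.trans ?_
    have h1 : (|a n| - (4 : ℝ) ^ n • S n)⁺ ≤ (v n)⁺ + ((1 / 2 : ℝ) ^ n) • w :=
      sup_le (sub_le_iff_le_add.1 (le_posPart _)) (add_nonneg (posPart_nonneg _) (hw' n))
    refine (norm_le_norm_of_le (posPart_nonneg _) h1).trans ((norm_add_le _ _).trans ?_)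
    rw [norm_smul, Real.norm_of_nonneg (by positivity)])
  linarith

end

/-! ### Order bounded operators on disjoint weakly null sequences -/

theorem sum_abs_le_of_signs {ι F : Type*} [AddCommGroup F] [Lattice F] [IsOrderedAddMonoid F]
    {s : Finset ι} {a : ι → F} {d : F}
    (h : ∀ b : ι → F, (∀ i, b i = a i ∨ b i = -a i) → ∑ i ∈ s, b i ≤ d) :
    ∑ i ∈ s, |a i| ≤ d := by
  classical
  induction s using Finset.induction_on generalizing d with
  | empty => simpa using h a fun i => Or.inl rfl
  | insert j s hj ih =>
    have key : ∀ c, c = a j ∨ c = -a j → ∑ i ∈ s, |a i| ≤ d - c := by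
      intro c hc
      refine ih fun b hb => ?_
      have h1 := h (Function.update b j c) fun i => by
        rcases eq_or_ne i j with rfl | hij
        · simpa using hc
        · simpa [hij] using hb i
      rw [Finset.sum_insert hj, Function.update_self,
        Finset.sum_congr rfl fun i hi =>
          Function.update_of_ne (ne_of_mem_of_not_mem hi hj) c b] at h1
      exact le_sub_iff_add_le'.2 h1
    rw [Finset.sum_insert hj, ← le_sub_iff_add_le]
    exact abs_le'.2 ⟨le_sub_comm.1 (key _ (Or.inl rfl)), le_sub_comm.1 (key _ (Or.inr rfl))⟩

/-- Mazur: otherwise Hahn–Banach separation keeps some functional above a positive constant along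
the sequence. -/
theorem exists_mem_convexHull_norm_lt {X : Type*} [NormedAddCommGroup X] [NormedSpace ℝ X]
    {x : ℕ → X} (hx : WeaklyNull x) {η : ℝ} (hη : 0 < η) :
    ∃ z ∈ convexHull ℝ (range x), ‖z‖ < η := by
  by_contra! hcon
  obtain ⟨f, u, h1, h2⟩ := geometric_hahn_banach_open (convex_ball (0 : X) η) Metric.isOpen_ball
    (convex_convexHull ℝ (range x)) (Set.disjoint_left.2 fun z hz hz' =>
      (hcon z hz').not_gt (by simpa using hz))
  have h3 := h1 0 (Metric.mem_ball_self hη)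
  rw [map_zero] at h3
  have h4 := ge_of_tendsto (weaklyNull_iff.1 hx f)
    (Eventually.of_forall fun n => h2 (x n) (subset_convexHull ℝ _ ⟨n, rfl⟩))
  linarith

section

variable {E : Type*} [NormedAddCommGroup E] [NormedSpace ℝ E] [Lattice E] [IsOrderedAddMonoid E]
  [IsOrderedModule ℝ E] [HasSolidNorm E]

/-- Sign changes keep the modulus of `∑ v i` within `∑ |v i|`, which equals `|∑ v i|` by
disjointness; so every signed sum is covered by `hT`. -/
theorem sum_abs_map_le {ι : Type*} {F : Type*} [NormedAddCommGroup F] [NormedSpace ℝ F]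
    [Lattice F] [IsOrderedAddMonoid F] (T : E →L[ℝ] F) {s : Finset ι} {v : ι → E} {d : F}
    (hv : ∀ i ∈ s, ∀ j ∈ s, i ≠ j → |v i| ⊓ |v j| = 0)
    (hT : ∀ y, |y| ≤ |∑ i ∈ s, v i| → T y ≤ d) : ∑ i ∈ s, |T (v i)| ≤ d := by
  refine sum_abs_le_of_signs fun b hb => ?_
  have hc : ∀ i, ∃ c : E, b i = T c ∧ |c| = |v i| := fun i => by
    rcases hb i with h | h
    · exact ⟨v i, h, rfl⟩
    · exact ⟨-v i, by rw [h, map_neg], abs_neg _⟩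
  choose c hbc hcv using hc
  rw [Finset.sum_congr rfl fun i _ => hbc i, ← map_sum]
  refine hT _ ?_
  rw [abs_sum_of_disjoint hv, ← Finset.sum_congr rfl fun i _ => hcv i]
  exact Finset.le_sum_of_subadditive (fun a : E => |a|) abs_zero.le abs_add_le s c

/-- If `f |T (x n)| ≥ δ` along a subsequence, take convex combinations `z k` of it with norm below
`4⁻ᵏ`. All `2ᵏ z k` lie in one interval `[-s, s]`, on which `T ≤ d`. Disjointness bounds the
weighted sum of the `|T (x n)|` by `2⁻ᵏ d`, so `δ ≤ 2⁻ᵏ f d` for every `k`. -/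
theorem OrderBoundedOp.tendsto_abs [CompleteSpace E] {F : Type*} [NormedAddCommGroup F]
    [NormedSpace ℝ F] [Lattice F] [IsOrderedAddMonoid F] [IsOrderedModule ℝ F] [HasSolidNorm F]
    {T : E →L[ℝ] F} (hT : OrderBoundedOp T) {x : ℕ → E} (hd : DisjointSeq x) (hx : WeaklyNull x)
    {f : StrongDual ℝ F} (hf : IsPositive f) :
    Tendsto (fun n => f |T (x n)|) atTop (𝓝 0) := by
  by_contra hcon
  obtain ⟨δ, hδ, φ, hφ, h⟩ :=
    exists_strictMono_le_of_not_tendsto (fun n => hf _ (abs_nonneg _)) hcon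
  have hx' : WeaklyNull fun n => x (φ n) :=
    weaklyNull_iff.2 fun g => (weaklyNull_iff.1 hx g).comp hφ.tendsto_atTop
  choose z hz hzn using fun k : ℕ =>
    exists_mem_convexHull_norm_lt hx' (η := (1 / 4 : ℝ) ^ k) (by positivity)
  have hterm : ∀ k, 0 ≤ (2 : ℝ) ^ k • |z k| := fun k => smul_nonneg (by positivity) (abs_nonneg _)
  have hsum : Summable fun k => (2 : ℝ) ^ k • |z k| := by
    refine Summable.of_norm_bounded (g := fun k => (1 / 2 : ℝ) ^ k) summable_geometric_two
      fun k => ?_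
    rw [norm_smul, norm_abs_eq_norm, Real.norm_of_nonneg (by positivity)]
    calc (2 : ℝ) ^ k * ‖z k‖ ≤ 2 ^ k * (1 / 4) ^ k :=
          mul_le_mul_of_nonneg_left (hzn k).le (by positivity)
      _ = (1 / 2) ^ k := by rw [← mul_pow]; norm_num
  set s := ∑' k, (2 : ℝ) ^ k • |z k|
  have hle : ∀ k, (2 : ℝ) ^ k • |z k| ≤ s := fun k => hsum.le_tsum k fun m _ => hterm m
  obtain ⟨c, d, hcd⟩ := hT (-s) s
  have hTd : ∀ y, |y| ≤ s → T y ≤ d := fun y hy =>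
    (hcd ⟨y, ⟨neg_le.1 ((neg_le_abs y).trans hy), (le_abs_self y).trans hy⟩, rfl⟩).2
  have key : ∀ k : ℕ, δ ≤ (1 / 2 : ℝ) ^ k * f d := by
    intro k
    have hzk := hz k
    rw [convexHull_eq_union_convexHull_finite_subsets] at hzk
    simp only [mem_iUnion] at hzk
    obtain ⟨t, ht, hzt⟩ := hzk
    obtain ⟨w, hw0, hw1, hwz⟩ := Finset.mem_convexHull'.1 hzt
    have h1 : ∑ a ∈ t, |T (w a • a)| ≤ ((1 / 2 : ℝ) ^ k) • d := by
      refine sum_abs_map_le T ?_ ?_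
      · intro a ha b hb hab
        obtain ⟨m, rfl⟩ := ht ha
        obtain ⟨n, rfl⟩ := ht hb
        rw [abs_smul_of_nonneg (hw0 _ ha), abs_smul_of_nonneg (hw0 _ hb)]
        refine smul_inf_smul_eq_zero (abs_nonneg _) (abs_nonneg _) (hd _ _ ?_) (hw0 _ ha)
          (hw0 _ hb)
        rintro h
        exact hab (congrArg x h)
      · intro y hy
        rw [hwz] at hy
        have h2 : T ((2 : ℝ) ^ k • y) ≤ d := hTd _ (by
          rw [abs_smul_of_nonneg (by positivity)]
          exact (smul_le_smul_of_nonneg_left hy (by positivity)).trans (hle k))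
        have h3 := smul_le_smul_of_nonneg_left h2 (by positivity : (0 : ℝ) ≤ (1 / 2) ^ k)
        rwa [map_smul, smul_smul, ← mul_pow, one_div, inv_mul_cancel₀ two_ne_zero, one_pow,
          one_smul, ← one_div] at h3
    have h2 := hf.mono h1
    rw [map_smul, smul_eq_mul, map_sum] at h2
    refine le_trans ?_ h2
    calc δ = ∑ a ∈ t, w a * δ := by rw [← Finset.sum_mul, hw1, one_mul]
      _ ≤ ∑ a ∈ t, f |T (w a • a)| := by
        refine Finset.sum_le_sum fun a ha => ?_
        obtain ⟨m, rfl⟩ := ht ha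
        rw [map_smul, abs_smul_of_nonneg (hw0 _ ha), map_smul, smul_eq_mul]
        exact mul_le_mul_of_nonneg_left (h m) (hw0 _ ha)
  have hlim : Tendsto (fun k : ℕ => (1 / 2 : ℝ) ^ k * f d) atTop (𝓝 0) := by
    simpa using (tendsto_pow_atTop_nhds_zero_of_lt_one (r := (1 / 2 : ℝ)) (by norm_num)
      (by norm_num)).mul_const (f d)
  linarith [ge_of_tendsto hlim (Eventually.of_forall key)]

theorem WeaklyNull.relativelyWeaklyCompact_range {X : Type*} [NormedAddCommGroup X]
    [NormedSpace ℝ X] {x : ℕ → X} (hx : WeaklyNull x) : RelativelyWeaklyCompact (range x) := by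
  have h : IsCompact (insert (0 : WeakSpace ℝ X) (range fun n => toWeakSpace ℝ X (x n))) :=
    hx.isCompact_insert_range
  refine h.closure_of_subset ?_
  rw [← range_comp]
  exact subset_insert _ _

theorem almostDunfordPettis_of_disjointBoundedNull [CompleteSpace E] {F : Type*}
    [NormedAddCommGroup F] [NormedSpace ℝ F] [Lattice F] [IsOrderedAddMonoid F]
    [IsOrderedModule ℝ F] [HasSolidNorm F] [CompleteSpace F]
    (hF : DisjointBoundedNull F) {T : E →L[ℝ] F} (hT : OrderBoundedOp T)
    (hTw : WeakAlmostLimited T) : AlmostDunfordPettis T := by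
  intro x hd hx
  have hA := hTw _ hx.relativelyWeaklyCompact_range
  rw [Metric.tendsto_nhds]
  intro ε hε
  obtain ⟨u, hu, huA⟩ := exists_almost_order_bound hA.1
    (fun a y ha hy hya hyd => hA.tendsto_norm hF ha hy hya hyd) (half_pos hε)
  have h1 : Tendsto (fun n => ‖|T (x n)| ⊓ u‖) atTop (𝓝 0) :=
    hF.tendsto_norm (fun n => le_inf (abs_nonneg _) hu) (fun n => inf_le_right) fun g hg =>
      squeeze_zero (fun n => hg _ (le_inf (abs_nonneg _) hu)) (fun n => hg.mono inf_le_left)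
        (hT.tendsto_abs hd hx hg)
  filter_upwards [h1.eventually_lt_const (half_pos hε)] with n hn
  rw [Real.dist_eq, sub_zero, abs_of_nonneg (norm_nonneg _), ← norm_abs_eq_norm]
  have h2 : |T (x n)| = |T (x n)| ⊓ u + (|T (x n)| - u)⁺ := by
    rw [inf_eq_sub_posPart_sub, sub_add_cancel]
  rw [h2]
  have h3 := huA (T (x n)) ⟨x n, ⟨n, rfl⟩, rfl⟩
  linarith [norm_add_le (|T (x n)| ⊓ u) ((|T (x n)| - u)⁺)]

end

/-! ### Weak compactness, and weak* null functionals on `ℓ^∞` -/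

open scoped BoundedContinuousFunction

section Bounded

variable {X : Type*} [NormedAddCommGroup X] [NormedSpace ℝ X]

theorem isBounded_of_forall_dual_bounded {S : Set X}
    (h : ∀ f : StrongDual ℝ X, ∃ C, ∀ x ∈ S, |f x| ≤ C) : Bornology.IsBounded S := by
  obtain ⟨C, hC⟩ := banach_steinhaus
    (g := fun x : S => NormedSpace.inclusionInDoubleDual ℝ X (x : X)) (fun f => by
      obtain ⟨C, hC⟩ := h f
      exact ⟨C, fun x => hC x x.2⟩)
  refine isBounded_iff_forall_norm_le.2 ⟨C, fun x hx => ?_⟩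
  have := hC ⟨x, hx⟩
  rwa [← (NormedSpace.inclusionInDoubleDualLi ℝ (E := X)).norm_map x]

theorem continuous_eval_weakSpace (f : StrongDual ℝ X) :
    Continuous fun x : WeakSpace ℝ X => f ((toWeakSpace ℝ X).symm x) :=
  WeakBilin.eval_continuous (topDualPairing ℝ X).flip f

theorem RelativelyWeaklyCompact.isBounded {W : Set X} (hW : RelativelyWeaklyCompact W) :
    Bornology.IsBounded W := by
  refine isBounded_of_forall_dual_bounded fun f => ?_
  obtain ⟨C, hC⟩ := (hW.image (continuous_eval_weakSpace f)).isBounded.exists_norm_le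
  exact ⟨C, fun x hx => hC _ ⟨toWeakSpace ℝ X x, subset_closure ⟨x, hx, rfl⟩, rfl⟩⟩

theorem RelativelyWeaklyCompact.image {Y : Type*} [NormedAddCommGroup Y] [NormedSpace ℝ Y]
    {W : Set X} (hW : RelativelyWeaklyCompact W) (P : X →L[ℝ] Y) :
    RelativelyWeaklyCompact (P '' W) := by
  refine (IsCompact.image hW (WeakSpace.map P).continuous).closure_of_subset ?_
  rintro _ ⟨_, ⟨x, hx, rfl⟩, rfl⟩
  exact ⟨toWeakSpace ℝ X x, subset_closure ⟨x, hx, rfl⟩, rfl⟩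

theorem WeaklyNull.exists_norm_le {x : ℕ → X} (hx : WeaklyNull x) : ∃ C, ∀ n, ‖x n‖ ≤ C := by
  obtain ⟨C, hC⟩ := hx.relativelyWeaklyCompact_range.isBounded.exists_norm_le
  exact ⟨C, fun n => hC _ ⟨n, rfl⟩⟩

theorem WeakStarNull.exists_norm_le [CompleteSpace X] {f : ℕ → StrongDual ℝ X}
    (hf : WeakStarNull f) : ∃ C, ∀ n, ‖f n‖ ≤ C :=
  banach_steinhaus fun x => by
    obtain ⟨C, hC⟩ :=
      (Metric.isBounded_range_of_tendsto _ (weakStarNull_iff.1 hf x)).exists_norm_le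
    exact ⟨C, fun n => hC _ ⟨n, rfl⟩⟩

end Bounded

/-- Rosenthal's lemma on uniformly bounded sequences of finitely additive measures. -/
theorem exists_infinite_diff_singleton_le {ν : ℕ → Set ℕ → ℝ} (h0 : ∀ k A, 0 ≤ ν k A)
    (hadd : ∀ k A B, Disjoint A B → ν k (A ∪ B) = ν k A + ν k B) {M : ℝ}
    (hM : ∀ k A, ν k A ≤ M) {η : ℝ} (hη : 0 < η) :
    ∃ A : Set ℕ, A.Infinite ∧ ∀ k ∈ A, ν k (A \ {k}) ≤ η := by
  have hmono : ∀ k {A B : Set ℕ}, A ⊆ B → ν k A ≤ ν k B := by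
    intro k A B h
    rw [← union_sdiff_cancel h, hadd k A (B \ A) disjoint_sdiff_right]
    linarith [h0 k (B \ A)]
  -- Induction on the mass in units of `η`. Split `A` into infinitely many infinite pieces; if each
  -- piece fails at some `κ p`, then `range κ` avoids `N p \ {κ p}` and loses mass `η` under `ν (κ
  -- p)`.
  have key : ∀ n : ℕ, ∀ A : Set ℕ, A.Infinite → (∀ k ∈ A, ν k A ≤ n * η) →
      ∃ A : Set ℕ, A.Infinite ∧ ∀ k ∈ A, ν k (A \ {k}) ≤ η := by
    intro n
    induction n with
    | zero =>
      intro A hA h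
      refine ⟨A, hA, fun k hk => (hmono k sdiff_subset).trans ((h k hk).trans ?_)⟩
      simpa using hη.le
    | succ n ih =>
      intro A hA h
      set e := hA.natEmbedding A
      set N : ℕ → Set ℕ := fun p => range fun j => (e (Nat.pair p j) : ℕ) with hN
      have hNA : ∀ p, N p ⊆ A := by
        rintro p _ ⟨j, rfl⟩
        exact (e _).2
      have hNi : ∀ p, (N p).Infinite := fun p => infinite_range_of_injective fun i j hij =>
        (Nat.pair_eq_pair.1 (e.injective (Subtype.ext hij))).2
      have hNd : ∀ p q k, k ∈ N p → k ∈ N q → p = q := by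
        rintro p q _ ⟨i, rfl⟩ ⟨j, hij⟩
        exact (Nat.pair_eq_pair.1 (e.injective (Subtype.ext hij))).1.symm
      by_cases hp : ∃ p, ∀ k ∈ N p, ν k (N p \ {k}) ≤ η
      · obtain ⟨p, hp⟩ := hp
        exact ⟨N p, hNi p, hp⟩
      · push Not at hp
        choose κ hκN hκ using hp
        refine ih (range κ) (infinite_range_of_injective fun p q hpq =>
          hNd p q (κ p) (hκN p) (hpq ▸ hκN q)) ?_
        rintro _ ⟨p, rfl⟩
        have h1 : Disjoint (range κ) (N p \ {κ p}) := by
          refine Set.disjoint_left.2 ?_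
          rintro _ ⟨q, rfl⟩ ⟨hq, hq'⟩
          exact hq' (congrArg κ (hNd q p _ (hκN q) hq))
        have h2 : range κ ∪ N p \ {κ p} ⊆ A := by
          refine union_subset ?_ (sdiff_subset.trans (hNA p))
          rintro _ ⟨q, rfl⟩
          exact hNA q (hκN q)
        have h3 := (hmono (κ p) h2).trans (h (κ p) (hNA p (hκN p)))
        rw [hadd _ _ _ h1] at h3
        push_cast at h3
        linarith [hκ p]
  obtain ⟨n, hn⟩ := exists_nat_ge (M / η)
  refine key n univ infinite_univ fun k _ => (hM k _).trans ?_
  rwa [← div_le_iff₀ hη]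

instance : IsOrderedModule ℝ (ℕ →ᵇ ℝ) where
  smul_le_smul_of_nonneg_left _ hc _ _ h := fun i => mul_le_mul_of_nonneg_left (h i) hc
  smul_le_smul_of_nonneg_right _ hb _ _ h := fun i => mul_le_mul_of_nonneg_right h (hb i)

/-- Rosenthal's lemma gives an infinite `A` for which `φ k`, `k ∈ A`, nearly ignores the other
blocks. Then `φ k (blk A) ≥ ε / 2` infinitely often, at the single element `blk A`. -/
theorem tendsto_norm_block {φ : ℕ → StrongDual ℝ (ℕ →ᵇ ℝ)} (hφ : WeakStarNull φ)
    {z : ℕ → ℕ →ᵇ ℝ} {C : ℝ} (hz : ∀ k, ‖z k‖ ≤ C)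
    (hd : ∀ j k, j ≠ k → ∀ i, z j i = 0 ∨ z k i = 0) {ε : ℝ} (hε : 0 < ε) :
    ¬ ∀ k, ε ≤ φ k (z k) := by
  classical
  intro hcon
  obtain ⟨M, hM⟩ := hφ.exists_norm_le
  have hC0 : 0 ≤ C := (norm_nonneg _).trans (hz 0)
  have hM0 : 0 ≤ M := (norm_nonneg _).trans (hM 0)
  -- `κ i` is the only block that can be nonzero at `i`; 0 is a default where all vanish.
  have hκ : ∀ i, ∃ k, ∀ j, j ≠ k → z j i = 0 := fun i => by
    by_cases h : ∃ k, z k i ≠ 0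
    · obtain ⟨k, hk⟩ := h
      exact ⟨k, fun j hj => (hd j k hj i).resolve_right hk⟩
    · push Not at h
      exact ⟨0, fun j _ => h j⟩
  choose κ hκ using hκ
  set blk : Set ℕ → ℕ →ᵇ ℝ := fun A => BoundedContinuousFunction.ofNormedAddCommGroupDiscrete
    (fun i => if κ i ∈ A then z (κ i) i else 0) C (fun i => by
      split_ifs
      · exact ((z _).norm_coe_le_norm i).trans (hz _)
      · simpa using hC0) with hblk
  have hblk_apply : ∀ A i, blk A i = if κ i ∈ A then z (κ i) i else 0 := fun A i => rfl
  have hblk_norm : ∀ A, ‖blk A‖ ≤ C := fun A => (BoundedContinuousFunction.norm_le hC0).2 fun i => by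
    rw [hblk_apply]
    split_ifs
    · exact ((z _).norm_coe_le_norm i).trans (hz _)
    · simpa using hC0
  have hblk_single : ∀ k, blk {k} = z k := fun k => by
    ext i
    rw [hblk_apply, mem_singleton_iff]
    split_ifs with h
    · rw [h]
    · exact (hκ i k (Ne.symm h)).symm
  have hblk_union : ∀ A B, Disjoint A B → blk (A ∪ B) = blk A + blk B := fun A B hAB => by
    ext i
    rw [BoundedContinuousFunction.add_apply, hblk_apply, hblk_apply, hblk_apply]
    by_cases hA : κ i ∈ A
    · simp [hA, Set.disjoint_left.1 hAB hA]
    · simp [hA]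
  have hblk_abs : ∀ A B, Disjoint A B → |blk (A ∪ B)| = |blk A| + |blk B| := fun A B hAB => by
    ext i
    change |blk (A ∪ B) i| = |blk A i| + |blk B i|
    rw [hblk_apply, hblk_apply, hblk_apply]
    by_cases hA : κ i ∈ A
    · simp [hA, Set.disjoint_left.1 hAB hA]
    · simp [hA]
  choose p hp hpn hpφ _ using fun k => exists_modulus (φ k)
  obtain ⟨A, hA, hAk⟩ := exists_infinite_diff_singleton_le (ν := fun k A => p k |blk A|)
    (M := M * C) (η := ε / 2)
    (fun k A => hp k _ (abs_nonneg _))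
    (fun k A B hAB => by rw [hblk_abs A B hAB, map_add])
    (fun k A => (le_abs_self _).trans (((p k).le_opNorm _).trans (by
      rw [norm_abs_eq_norm]
      exact mul_le_mul ((hpn k).trans (hM k)) (hblk_norm A) (norm_nonneg _) hM0)))
    (half_pos hε)
  have h1 : ∀ k ∈ A, ε / 2 ≤ φ k (blk A) := by
    intro k hk
    have h2 : blk A = z k + blk (A \ {k}) := by
      rw [← hblk_single k, ← hblk_union _ _ disjoint_sdiff_right, union_sdiff_cancel (by simpa)]
    rw [h2, map_add]
    have h3 := (abs_le.1 ((hpφ k (blk (A \ {k}))).trans (hAk k hk))).1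
    linarith [hcon k]
  have h4 := (weakStarNull_iff.1 hφ (blk A)).eventually_lt_const (half_pos hε)
  obtain ⟨k, hk, hkA⟩ := (h4.and_frequently (Nat.frequently_atTop_iff_infinite.2 hA)).exists
  exact absurd (h1 k hkA) hk.not_ge

/-- `Ultrafilter ℕ` plays the role of βℕ, so `ℓ^∞` becomes `C(βℕ)`. -/
theorem exists_continuous_extension (b : ℕ →ᵇ ℝ) :
    ∃ G : C(Ultrafilter ℕ, ℝ), (∀ n, G (pure n) = b n) ∧ (∀ ω, |G ω| ≤ ‖b‖) ∧
      ∀ ω : Ultrafilter ℕ, Tendsto b ω (𝓝 (G ω)) := by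
  set h : ℕ → Icc (-‖b‖) ‖b‖ := fun n => ⟨b n, abs_le.1 (b.norm_coe_le_norm n)⟩
  set e : Ultrafilter ℕ → Icc (-‖b‖) ‖b‖ := Ultrafilter.extend h
  have he : Continuous e := continuous_ultrafilter_extend h
  refine ⟨⟨fun ω => (e ω : ℝ), continuous_subtype_val.comp he⟩, fun n => ?_,
    fun ω => abs_le.2 (e ω).2, fun ω => ?_⟩
  · exact congrArg Subtype.val (ultrafilter_extend_pure h n)
  · have h1 : Tendsto h ω (𝓝 (e ω)) := ultrafilter_extend_eq_iff.1 rfl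
    exact (continuous_subtype_val.tendsto _).comp h1

/-- The lattice operations of `ℓ^∞` are weakly sequentially continuous at zero. -/
theorem tendsto_abs_of_weaklyNull {b : ℕ → ℕ →ᵇ ℝ} (hb : WeaklyNull b)
    {μ : StrongDual ℝ (ℕ →ᵇ ℝ)} (hμ : IsPositive μ) :
    Tendsto (fun k => μ |b k|) atTop (𝓝 0) := by
  obtain ⟨C, hC⟩ := hb.exists_norm_le
  borelize (Ultrafilter ℕ)
  choose G hGpure hGb hGlim using fun k => exists_continuous_extension (b k)
  let R : CompactlySupportedContinuousMap (Ultrafilter ℕ) ℝ → (ℕ →ᵇ ℝ) := fun g =>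
    (BoundedContinuousFunction.mkOfCompact g.toContinuousMap).compContinuous
      ⟨pure, continuous_of_discreteTopology⟩
  let Λ₀ : CompactlySupportedContinuousMap (Ultrafilter ℕ) ℝ →ₗ[ℝ] ℝ :=
    { toFun := fun g => μ (R g)
      map_add' := fun g h => by rw [← map_add]; rfl
      map_smul' := fun c g => by rw [RingHom.id_apply, ← map_smul]; rfl }
  let Λ := PositiveLinearMap.mk₀ Λ₀ (fun g hg => hμ _ fun n =>
    CompactlySupportedContinuousMap.le_def.1 hg (pure n))
  let H : ℕ → CompactlySupportedContinuousMap (Ultrafilter ℕ) ℝ := fun k =>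
    CompactlySupportedContinuousMap.continuousMapEquiv ⟨fun ω => |G k ω|, (G k).continuous.abs⟩
  have hH : ∀ k, μ |b k| = ∫ ω, |G k ω| ∂(RealRMK.rieszMeasure Λ) := by
    intro k
    refine Eq.trans ?_ (RealRMK.integral_rieszMeasure Λ (H k)).symm
    change μ |b k| = μ (R (H k))
    congr 1
    ext n
    change |b k n| = |G k (pure n)|
    rw [hGpure]
  -- Evaluation at `ω` is a bounded functional on `ℓ^∞`, so weak nullity is pointwise nullity on βℕ,
  -- and dominated convergence applies.
  have hlim : ∀ ω, Tendsto (fun k => |G k ω|) atTop (𝓝 0) := by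
    intro ω
    obtain ⟨δ, hδ⟩ := exists_weakStar_ultrafilter_limit
      (f := fun n => BoundedContinuousFunction.evalCLM ℝ n) (M := 1)
      (fun n => ContinuousLinearMap.opNorm_le_bound _ zero_le_one fun x => by
        rw [one_mul]; exact x.norm_coe_le_norm n) ω
    have h1 : ∀ k, G k ω = δ (b k) := fun k => tendsto_nhds_unique (hGlim k ω) (hδ (b k))
    simp_rw [h1]
    simpa using (weaklyNull_iff.1 hb δ).abs
  simp_rw [hH]
  have h2 := MeasureTheory.tendsto_integral_of_dominated_convergence
    (μ := RealRMK.rieszMeasure Λ) (F := fun k ω => |G k ω|) (f := fun _ => 0) (fun _ => C)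
    (fun k => (G k).continuous.abs.aestronglyMeasurable)
    (MeasureTheory.integrable_const C)
    (fun k => Eventually.of_forall fun ω => by
      rw [Real.norm_eq_abs, abs_abs]; exact (hGb k ω).trans (hC k))
    (Eventually.of_forall hlim)
  simpa using h2

theorem WeakStarNull.comp_strictMono {X : Type*} [NormedAddCommGroup X] [NormedSpace ℝ X]
    {f : ℕ → StrongDual ℝ X} (hf : WeakStarNull f) {s : ℕ → ℕ} (hs : StrictMono s) :
    WeakStarNull fun n => f (s n) :=
  weakStarNull_iff.2 fun x => (weakStarNull_iff.1 hf x).comp hs.tendsto_atTop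

theorem WeaklyNull.comp_strictMono {X : Type*} [NormedAddCommGroup X] [NormedSpace ℝ X]
    {x : ℕ → X} (hx : WeaklyNull x) {s : ℕ → ℕ} (hs : StrictMono s) :
    WeaklyNull fun n => x (s n) :=
  weaklyNull_iff.2 fun f => (weaklyNull_iff.1 hx f).comp hs.tendsto_atTop

/-- Otherwise the moduli of the `φ k` stay away from 0 on `|b k|`, hence on disjoint minorants `y
k`. Riesz–Kantorovich returns to `φ` with `|z k| ≤ y k`, against `tendsto_norm_block`. -/
theorem WeakStarNull.tendsto_apply {φ : ℕ → StrongDual ℝ (ℕ →ᵇ ℝ)} (hφ : WeakStarNull φ)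
    {b : ℕ → ℕ →ᵇ ℝ} (hb : WeaklyNull b) : Tendsto (fun k => φ k (b k)) atTop (𝓝 0) := by
  rw [tendsto_zero_iff_abs_tendsto_zero]
  by_contra hcon
  obtain ⟨ε, hε, s, hs, h⟩ := exists_strictMono_le_of_not_tendsto (fun n => abs_nonneg _) hcon
  obtain ⟨M, hM⟩ := hφ.exists_norm_le
  obtain ⟨C, hC⟩ := hb.exists_norm_le
  choose p hp hpn hpφ hpa using fun k => exists_modulus (φ (s k))
  have hle : ∀ x : ℕ →ᵇ ℝ, ‖x‖ ≤ C → |x| ≤ BoundedContinuousFunction.const ℕ C := fun x hx i =>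
    (x.norm_coe_le_norm i).trans hx
  obtain ⟨t, ht, y, hy0, hyb, hyd, hyp⟩ := exists_disjoint_minorant
    (d := fun k => |b (s k)|) (fun k => abs_nonneg _) (fun k => hle _ (hC (s k))) hp
    (fun k => (hpn k).trans (hM _))
    (fun g hg => tendsto_abs_of_weaklyNull (hb.comp_strictMono hs) hg) hε
    (fun k => (h k).trans (hpφ k _))
  choose z hzy hz using fun k => hpa (t k) (y k) (hy0 k) (ε / 4) (by positivity)
  refine tendsto_norm_block (hφ.comp_strictMono (hs.comp ht)) (z := z) (C := C) ?_ ?_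
    (ε := ε / 4) (by positivity) ?_
  · intro k
    refine (norm_le_norm_of_abs_le_abs (?_ : |z k| ≤ |b (s (t k))|)).trans (hC _)
    exact (hzy k).trans (hyb k)
  · intro j k hjk i
    have h1 : y j i ⊓ y k i = 0 := congrArg (fun x : ℕ →ᵇ ℝ => x i) (hyd j k hjk)
    have h2 : ∀ l, |z l i| ≤ y l i := fun l => hzy l i
    rcases min_choice (y j i) (y k i) with h3 | h3
    · left
      have h4 := h2 j
      rw [← h3] at h4
      exact abs_nonpos_iff.1 (h4.trans h1.le)
    · right
      have h4 := h2 k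
      rw [← h3] at h4
      exact abs_nonpos_iff.1 (h4.trans h1.le)
  · intro k
    have h1 := hz k
    have h2 := hyp k
    change ε / 4 ≤ φ (s (t k)) (z k)
    linarith

theorem WeakStarNull.tendstoUniformlyOn {φ : ℕ → StrongDual ℝ (ℕ →ᵇ ℝ)} (hφ : WeakStarNull φ)
    {V : Set (ℕ →ᵇ ℝ)} (hV : RelativelyWeaklyCompact V) :
    TendstoUniformlyOn (fun n x => φ n x) (fun _ => 0) atTop V := by
  rw [Metric.tendstoUniformlyOn_iff]
  by_contra! hcon
  obtain ⟨ε, hε, hcon⟩ := hcon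
  obtain ⟨s, hs, hs'⟩ := extraction_of_frequently_atTop hcon
  choose v hvV hv using hs'
  -- The coordinate map is weakly continuous and injective into the metrizable `ℕ → ℝ`. It gives a
  -- coordinatewise convergent subsequence, which weak compactness upgrades to weak convergence.
  have hcoord : Continuous fun (x : WeakSpace ℝ (ℕ →ᵇ ℝ)) (i : ℕ) =>
      (toWeakSpace ℝ (ℕ →ᵇ ℝ)).symm x i :=
    continuous_pi fun i => continuous_eval_weakSpace (BoundedContinuousFunction.evalCLM ℝ i)
  have hvL : ∀ k, toWeakSpace ℝ (ℕ →ᵇ ℝ) (v k) ∈ closure (toWeakSpace ℝ (ℕ →ᵇ ℝ) '' V) :=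
    fun k => subset_closure ⟨v k, hvV k, rfl⟩
  obtain ⟨_, ⟨w, hwL, rfl⟩, t, ht, hlim⟩ := (IsCompact.image hV hcoord).tendsto_subseq
    (fun k => ⟨_, hvL k, rfl⟩)
  have hlim2 : Tendsto (fun k => toWeakSpace ℝ (ℕ →ᵇ ℝ) (v (t k))) atTop (𝓝 w) := by
    refine IsCompact.le_nhds_of_unique_clusterPt hV
      (Filter.mem_map.2 (univ_mem' fun k => hvL (t k))) fun x _ hx => ?_
    have h1 : MapClusterPt x atTop fun k => toWeakSpace ℝ (ℕ →ᵇ ℝ) (v (t k)) := hx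
    have h2 := h1.continuousAt_comp hcoord.continuousAt
    have h3 := eq_of_nhds_neBot (h2.neBot.mono (inf_le_inf_left _ hlim))
    exact (toWeakSpace ℝ (ℕ →ᵇ ℝ)).symm.injective (DFunLike.coe_injective h3)
  set w' := (toWeakSpace ℝ (ℕ →ᵇ ℝ)).symm w
  have hnull : WeaklyNull fun k => v (t k) - w' := weaklyNull_iff.2 fun f => by
    have h1 := ((continuous_eval_weakSpace f).tendsto w).comp hlim2
    have h2 : Tendsto (fun k => f (v (t k)) - f w') atTop (𝓝 (f w' - f w')) :=
      Tendsto.sub_const h1 _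
    simpa using h2
  have hφ' := hφ.comp_strictMono (hs.comp ht)
  have h1 := (hφ'.tendsto_apply hnull).add (weakStarNull_iff.1 hφ' w')
  have h2 : Tendsto (fun k => φ (s (t k)) (v (t k))) atTop (𝓝 0) := by
    simpa using h1
  have h3 := ge_of_tendsto h2.abs (b := ε) (Eventually.of_forall fun k => by
    have := hv (t k)
    rwa [dist_comm, Real.dist_eq, sub_zero] at this)
  rw [abs_zero] at h3
  linarith

/-! ### Return to order continuity; factorization through `ℓ^∞` -/

variable {E : Type*} [NormedAddCommGroup E] [NormedSpace ℝ E] [Lattice E] [IsOrderedAddMonoid E]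
  [IsOrderedModule ℝ E] [HasSolidNorm E]

theorem IsPositive.tendsto_of_sum_le {g : StrongDual ℝ E} (hg : IsPositive g) {d : ℕ → E} {u : E}
    (h0 : ∀ n, 0 ≤ d n) (hu : ∀ N, ∑ n ∈ Finset.range N, d n ≤ u) :
    Tendsto (fun n => g (d n)) atTop (𝓝 0) :=
  (summable_of_sum_range_le (c := g u) (fun n => hg _ (h0 n)) fun N => by
    rw [← map_sum]; exact hg.mono (hu N)).tendsto_atTop_zero

/-- A non-Cauchy decreasing net has increments of norm at least ε with order bounded partial sums.
Positive functionals kill such increments, so `tendsto_norm` applies. The limit of a Cauchy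
decreasing net is its infimum. -/
theorem DisjointBoundedNull.hasOrderContinuousNorm [CompleteSpace E]
    (hE : DisjointBoundedNull E) : HasOrderContinuousNorm E := by
  intro ι _ _ _ x hx hglb
  have hx0 : ∀ i, 0 ≤ x i := fun i => hglb.1 ⟨i, rfl⟩
  have hosc : ∀ ε > 0, ∃ i, ∀ j, i ≤ j → ‖x i - x j‖ < ε := by
    by_contra! hcon
    obtain ⟨ε, hε, hcon⟩ := hcon
    choose next hle hnext using hcon
    let a : ℕ → ι := fun n => Nat.rec (Classical.arbitrary ι) (fun _ i => next i) n
    have ha : ∀ n, a (n + 1) = next (a n) := fun n => rfl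
    have hd0 : ∀ n, 0 ≤ x (a n) - x (a (n + 1)) := fun n => sub_nonneg.2 (hx (hle _))
    have hsum : ∀ N, ∑ n ∈ Finset.range N, (x (a n) - x (a (n + 1))) ≤ x (a 0) := fun N => by
      rw [Finset.sum_range_sub' (fun n => x (a n))]
      exact sub_le_self _ (hx0 _)
    have hdu : ∀ n, x (a n) - x (a (n + 1)) ≤ x (a 0) := fun n =>
      (Finset.single_le_sum (f := fun n => x (a n) - x (a (n + 1))) (fun i _ => hd0 i)
        (Finset.self_mem_range_succ n)).trans (hsum (n + 1))
    have h := ge_of_tendsto (hE.tendsto_norm hd0 hdu fun g hg => hg.tendsto_of_sum_le hd0 hsum)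
      (Eventually.of_forall fun n => hnext (a n))
    linarith
  have hcauchy : Cauchy (map x atTop) := by
    refine Metric.cauchy_iff.2 ⟨inferInstance, fun ε hε => ?_⟩
    obtain ⟨i, hi⟩ := hosc (ε / 2) (half_pos hε)
    refine ⟨x '' Ici i, image_mem_map (Ici_mem_atTop i), ?_⟩
    rintro _ ⟨j, hj, rfl⟩ _ ⟨k, hk, rfl⟩
    have h1 := hi j hj
    have h2 := hi k hk
    rw [dist_eq_norm]
    calc ‖x j - x k‖ = ‖(x i - x k) - (x i - x j)‖ := by congr 1; abel
      _ ≤ ‖x i - x k‖ + ‖x i - x j‖ := norm_sub_le _ _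
      _ < ε := by linarith
  obtain ⟨l, hl⟩ := CompleteSpace.complete hcauchy
  have hl' : Tendsto x atTop (𝓝 l) := hl
  have hl0 : l = 0 := le_antisymm
    (hglb.2 (by
      rintro _ ⟨i, rfl⟩
      exact le_of_tendsto hl' ((eventually_ge_atTop i).mono fun j hj => hx hj)))
    (ge_of_tendsto hl' (Eventually.of_forall hx0))
  rw [hl0] at hl'
  simpa using hl'.norm

/-- A positive series with order bounded partial sums defines a positive operator on `ℓ^∞`. -/
theorem exists_lInfty_map (hE : SigmaDedekindComplete E) {v : ℕ → E} {u : E}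
    (h0 : ∀ n, 0 ≤ v n) (hu : ∀ N, ∑ n ∈ Finset.range N, v n ≤ u) :
    ∃ L : (ℕ →ᵇ ℝ) →L[ℝ] E, (∀ c, 0 ≤ c → 0 ≤ L c) ∧
      ∀ (c : ℕ →ᵇ ℝ), 0 ≤ c → IsLUB (range fun N => ∑ n ∈ Finset.range N, c n • v n) (L c) := by
  set S : (ℕ →ᵇ ℝ) → ℕ → E := fun c N => ∑ n ∈ Finset.range N, c n • v n with hS
  have hterm : ∀ c : ℕ →ᵇ ℝ, 0 ≤ c → ∀ n, 0 ≤ c n • v n := fun c hc n => smul_nonneg (hc n) (h0 n)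
  have hSm : ∀ c : ℕ →ᵇ ℝ, 0 ≤ c → Monotone (S c) := fun c hc M N h =>
    Finset.sum_le_sum_of_subset_of_nonneg (Finset.range_mono h) fun n _ _ => hterm c hc n
  have hSu : ∀ c : ℕ →ᵇ ℝ, ∀ N, S c N ≤ ‖c‖ • u := fun c N => by
    refine le_trans ?_ (smul_le_smul_of_nonneg_left (hu N) (norm_nonneg c))
    rw [Finset.smul_sum]
    exact Finset.sum_le_sum fun n _ =>
      smul_le_smul_of_nonneg_right ((le_abs_self _).trans (c.norm_coe_le_norm n)) (h0 n)
  choose q hq using fun c : ℕ →ᵇ ℝ => hE (range (S c)) (countable_range _) (range_nonempty _)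
    ⟨‖c‖ • u, by rintro _ ⟨N, rfl⟩; exact hSu c N⟩
  obtain ⟨L, hL⟩ := exists_linearMap_eq_on_cone q
    (by
      intro c d hc hd
      refine (hq (c + d)).unique ⟨?_, ?_⟩
      · rintro _ ⟨N, rfl⟩
        have : S (c + d) N = S c N + S d N := by
          simp [hS, add_smul, Finset.sum_add_distrib]
        rw [this]
        exact add_le_add ((hq c).1 ⟨N, rfl⟩) ((hq d).1 ⟨N, rfl⟩)
      · intro b hb
        rw [← le_sub_iff_add_le]
        refine (hq c).2 ?_
        rintro _ ⟨M, rfl⟩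
        rw [le_sub_comm]
        refine (hq d).2 ?_
        rintro _ ⟨N, rfl⟩
        rw [le_sub_iff_add_le']
        refine le_trans ?_ (hb ⟨max M N, rfl⟩)
        have : S (c + d) (max M N) = S c (max M N) + S d (max M N) := by
          simp [hS, add_smul, Finset.sum_add_distrib]
        change _ ≤ S (c + d) (max M N)
        rw [this]
        exact add_le_add (hSm c hc (le_max_left _ _)) (hSm d hd (le_max_right _ _)))
    (by
      intro r c hr hc
      have h1 := (OrderIso.isLUB_image' (OrderIso.smulRight (β := E) hr)).2 (hq c)
      refine (hq (r • c)).unique ?_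
      convert h1 using 1
      swap
      · rfl
      rw [← range_comp]
      congr 1
      ext N
      simp [hS, Finset.smul_sum, smul_smul])
  have hpos : ∀ c, 0 ≤ c → 0 ≤ L c := fun c hc => by
    rw [hL c hc]
    exact (hq c).1 ⟨0, by simp [hS]⟩
  have hbd : ∀ c, ‖L c‖ ≤ ‖u‖ * ‖c‖ := fun c => by
    have h1 : ∀ a b, a ≤ b → L a ≤ L b := fun a b hab => by
      have := hpos _ (sub_nonneg.2 hab)
      rwa [map_sub, sub_nonneg] at this
    have h2 : |L c| ≤ L |c| := abs_le'.2 ⟨h1 _ _ (le_abs_self c), by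
      rw [← map_neg]; exact h1 _ _ (neg_le_abs c)⟩
    have h3 : L |c| ≤ ‖c‖ • u := by
      rw [hL _ (abs_nonneg c)]
      refine (hq _).2 ?_
      rintro _ ⟨N, rfl⟩
      exact (hSu |c| N).trans_eq (by rw [norm_abs_eq_norm])
    refine (norm_le_norm_of_abs_le_abs ((h2.trans h3).trans (le_abs_self _))).trans ?_
    rw [norm_smul, norm_norm, mul_comm]
  refine ⟨L.mkContinuous ‖u‖ hbd, hpos, fun c hc => ?_⟩
  change IsLUB (range (S c)) (L c)
  rw [hL c hc]
  exact hq c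

/-- Coordinate functionals of a disjoint sequence bounded away from zero in norm. -/
theorem exists_lInfty_coordinates {v : ℕ → E} (h0 : ∀ n, 0 ≤ v n)
    (hd : ∀ m n, m ≠ n → v m ⊓ v n = 0) {ε : ℝ} (hε : 0 < ε) (hv : ∀ n, ε ≤ ‖v n‖) :
    ∃ P : E →L[ℝ] ℕ →ᵇ ℝ, (∀ x, 0 ≤ x → 0 ≤ P x) ∧ ∀ m n, P (v m) n = if n = m then 1 else 0 := by
  -- Norming functionals localized at `v n` and rescaled; being carried by `v n`, they vanish on the
  -- other `v m`.
  have hex : ∀ n, ∃ g : StrongDual ℝ E, IsPositive g ∧ ‖g‖ ≤ ε⁻¹ ∧ IsCarriedBy g (v n) ∧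
      g (v n) = 1 := by
    intro n
    obtain ⟨f, hf, hf1, hfv⟩ := exists_isPositive_norming (h0 n)
    obtain ⟨g, hg, hgn, hgc, hgv⟩ := exists_isCarriedBy hf (h0 n)
    have hvn : 0 < ‖v n‖ := hε.trans_le (hv n)
    refine ⟨‖v n‖⁻¹ • g, fun x hx => mul_nonneg (inv_nonneg.2 hvn.le) (hg x hx), ?_,
      fun x hx => (hgc x hx).const_mul _, ?_⟩
    · rw [norm_smul, norm_inv, norm_norm]
      exact (mul_le_of_le_one_right (inv_nonneg.2 hvn.le) (hgn.trans hf1)).trans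
        (inv_anti₀ hε (hv n))
    · change ‖v n‖⁻¹ * g (v n) = 1
      rw [hgv, hfv, inv_mul_cancel₀ hvn.ne']
  choose g hg hgn hgc hgv using hex
  have hgx : ∀ x n, ‖g n x‖ ≤ ε⁻¹ * ‖x‖ := fun x n =>
    ((g n).le_opNorm x).trans (mul_le_mul_of_nonneg_right (hgn n) (norm_nonneg x))
  let P : E →ₗ[ℝ] ℕ →ᵇ ℝ :=
    { toFun := fun x => BoundedContinuousFunction.ofNormedAddCommGroupDiscrete
        (fun n => g n x) (ε⁻¹ * ‖x‖) (hgx x)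
      map_add' := fun x y => by ext n; exact map_add (g n) x y
      map_smul' := fun c x => by ext n; exact map_smul (g n) c x }
  refine ⟨P.mkContinuous ε⁻¹ fun x => (BoundedContinuousFunction.norm_le (by positivity)).2 (hgx x),
    fun x hx n => hg n x hx, fun m n => ?_⟩
  change g n (v m) = _
  split_ifs with h
  · rw [h, hgv]
  · exact (hgc n).eq_zero (h0 m) (h0 n) (hd m n (Ne.symm h))

theorem orderBoundedOp_of_nonneg {F : Type*} [NormedAddCommGroup F] [NormedSpace ℝ F] [Lattice F]
    [IsOrderedAddMonoid F] {T : E →L[ℝ] F} (hT : ∀ x, 0 ≤ x → 0 ≤ T x) : OrderBoundedOp T := by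
  have h1 : ∀ a b, a ≤ b → T a ≤ T b := fun a b hab => by
    have := hT _ (sub_nonneg.2 hab)
    rwa [map_sub, sub_nonneg] at this
  intro a b
  refine ⟨T a, T b, ?_⟩
  rintro _ ⟨x, hx, rfl⟩
  exact ⟨h1 _ _ hx.1, h1 _ _ hx.2⟩

/-- Operators that factor through `ℓ^∞` are weak almost limited. -/
theorem weakAlmostLimited_comp {X : Type*} [NormedAddCommGroup X] [NormedSpace ℝ X]
    (P : X →L[ℝ] ℕ →ᵇ ℝ) (L : (ℕ →ᵇ ℝ) →L[ℝ] E) : WeakAlmostLimited (L.comp P) := by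
  intro W hW
  refine ⟨(hW.image _).isBounded, fun f _ hf => ?_⟩
  have hφ : WeakStarNull fun n => (f n).comp L :=
    weakStarNull_iff.2 fun c => weakStarNull_iff.1 hf (L c)
  have h := hφ.tendstoUniformlyOn (hW.image P)
  rw [Metric.tendstoUniformlyOn_iff] at h ⊢
  intro ε hε
  filter_upwards [h ε hε] with n hn
  rintro _ ⟨x, hx, rfl⟩
  exact hn (P x) ⟨x, hx, rfl⟩

/-- A counterexample `v` spans a copy of `c₀` on which the positive operator `L ∘ P` is the
identity, so `L ∘ P` is not almost Dunford–Pettis. -/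
theorem disjointBoundedNull_of_almostDunfordPettis (hE : SigmaDedekindComplete E)
    (h : ∀ T : E →L[ℝ] E, OrderBoundedOp T → WeakAlmostLimited T → AlmostDunfordPettis T) :
    DisjointBoundedNull E := by
  intro u y hy0 hyu hyd
  by_contra hcon
  obtain ⟨ε, hε, s, hs, hv⟩ := exists_strictMono_le_of_not_tendsto (fun n => norm_nonneg _) hcon
  set v : ℕ → E := fun n => y (s n) with hvdef
  have h0 : ∀ n, 0 ≤ v n := fun n => hy0 _
  have hd : ∀ m n, m ≠ n → v m ⊓ v n = 0 := fun m n hmn => hyd _ _ (hs.injective.ne hmn)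
  have hsum : ∀ N, ∑ n ∈ Finset.range N, v n ≤ u := fun N =>
    sum_le_of_disjoint (fun n _ => h0 n) ((hy0 0).trans (hyu 0)) (fun n _ => hyu _)
      fun m _ n _ hmn => hd m n hmn
  obtain ⟨L, hL0, hL⟩ := exists_lInfty_map hE h0 hsum
  obtain ⟨P, hP0, hP⟩ := exists_lInfty_coordinates h0 hd hε hv
  have hLP : ∀ m, L (P (v m)) = v m := by
    intro m
    refine (hL _ (hP0 _ (h0 m))).unique ?_
    have hS : ∀ N, ∑ n ∈ Finset.range N, P (v m) n • v n = if m < N then v m else 0 := by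
      intro N
      simp [hP, ite_smul]
    constructor
    · rintro _ ⟨N, rfl⟩
      change ∑ n ∈ Finset.range N, P (v m) n • v n ≤ v m
      rw [hS]
      split_ifs
      · exact le_rfl
      · exact h0 m
    · intro b hb
      refine le_trans (le_of_eq ?_) (hb ⟨m + 1, rfl⟩)
      change v m = ∑ n ∈ Finset.range (m + 1), P (v m) n • v n
      rw [hS, if_pos (Nat.lt_succ_self m)]
  have hweak : WeaklyNull v := weaklyNull_iff.2 fun f => by
    obtain ⟨p, hp, -, hpf, -⟩ := exists_modulus f
    refine squeeze_zero_norm (fun n => ?_) (hp.tendsto_of_sum_le h0 hsum)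
    rw [Real.norm_eq_abs]
    refine (hpf (v n)).trans ?_
    rw [abs_of_nonneg (h0 n)]
  have hlim := h (L.comp P) (orderBoundedOp_of_nonneg fun x hx => hL0 _ (hP0 _ hx))
    (weakAlmostLimited_comp P L) v
    (fun m n hmn => by rw [abs_of_nonneg (h0 m), abs_of_nonneg (h0 n), hd m n hmn]) hweak
  have h1 := ge_of_tendsto hlim (b := ε) (Eventually.of_forall fun n => by
    change ε ≤ ‖L (P (v n))‖
    rw [hLP]
    exact hv n)
  linarith

end BanachLattice

theorem mainTheorem9 {E : Type*} [NormedAddCommGroup E] [NormedSpace ℝ E] [CompleteSpace E]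
    [Lattice E] [IsOrderedAddMonoid E] [IsOrderedModule ℝ E] [HasSolidNorm E]
    (hE : BanachLattice.SigmaDedekindComplete E) :
    BanachLattice.HasOrderContinuousNorm E ↔
      ∀ T : E →L[ℝ] E, BanachLattice.OrderBoundedOp T → BanachLattice.WeakAlmostLimited T →
        BanachLattice.AlmostDunfordPettis T :=
  ⟨fun hoc _ hT hTw => BanachLattice.almostDunfordPettis_of_disjointBoundedNull
      (hoc.disjointBoundedNull hE) hT hTw,
    fun h => (BanachLattice.disjointBoundedNull_of_almostDunfordPettis hE
      h).hasOrderContinuousNorm⟩
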